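/- Let $n\ge 1$, $0\le n_1\le n-1$, $\mathcal I_1=\{1,\dots,n_1\}$, $\mathcal I_2=\{n_1+1,\dots,n\}$, let $\mathcal X_1,\dots,\mathcal X_{n-1}$ and $\mathcal X_n=\mathcal Y$ be real finite-dimensional Euclidean spaces, $\mathcal A_i:\mathcal X_i\to\mathcal Y$ linear for $i\le n-1$, $b\in\mathcal Y$, and consider $$\min_{x_1,\dots,x_n}\ \sum_{i=1}^n h_i(x_i)\quad\text{s.t.}\quad \sum_{i=1}^{n-1}\mathcal A_ix_i+x_n=b, \tag{P}$$ where $h_i:\mathcal X_i\to\mathbb R$ is convex and $C^2$ with Lipschitz gradient for $i\in\mathcal I_1$, and $h_i:\mathcal X_i\to(-\infty,+\infty]$ is proper, closed and convex for $i\in\mathcal I_2$. Assume that (P) has an optimal solution and that Slater's condition holds: there are $x_i\in\operatorname{ri}(\operatorname{dom}h_i)$, $i=1,\dots,n$, with $\sum_{i<n}\mathcal A_ix_i+x_n=b$. For $\sigma>0$, $x=(x_1,\dots,x_{n-1})$ and $z=(z_{n_1+1},\dots,z_n)$ with $z_i\in\mathcal X_i$, put $$\Phi(x;z)=\inf_{y,\,x_n}\Big\{\sum_{i\in\mathcal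 I_1}h_i(x_i)+\sum_{i\in\mathcal I_2\setminus\{n\}}h_i(y_i)+h_n(x_n)-\tfrac1{2\sigma}\sum_{i\in\mathcal I_2}\|z_i\|^2+\tfrac\sigma2\Big\|\sum_{i<n}\mathcal A_ix_i+x_n-b+\tfrac{z_n}\sigma\Big\|^2+\tfrac\sigma2\sum_{i\in\mathcal I_2\setminus\{n\}}\Big\|x_i-y_i-\tfrac{z_i}\sigma\Big\|^2\Big\},$$ the infimum being over $y=(y_i)_{i\in\mathcal I_2\setminus\{n\}}$, $y_i\in\mathcal X_i$, and $x_n\in\mathcal Y$, and let $F(x,z)=(\nabla_x\Phi(x;z),\,-\nabla_z\Phi(x;z))$. Let $(\tilde x,\tilde z)$, with $\tilde x=(\tilde x_1,\dots,\tilde x_n)$ and $\tilde z=(\tilde z_{n_1+1},\dots,\tilde z_n)$, be an optimal pair, i.e. satisfy the KKT system $$\sum_{i<n}\mathcal A_i\tilde x_i+\tilde x_n=b,\qquad -\tilde z_i\in\partial h_i(\tilde x_i)\ (i\in\mathcal I_2),\qquad \mathcal A_i^*\tilde z_n+\nabla h_i(\tilde x_i)=0\ (i\in\mathcal I_1),\qquad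 \mathcal A_i^*\tilde z_n-\tilde z_i=0\ (i\in\mathcal I_2\setminus\{n\}),$$ and suppose strict complementarity: $-\tilde z_i\in\operatorname{ri}\partial h_i(\tilde x_i)$ for all $i\in\mathcal I_2$. Let $p\ge 2$ be an integer and suppose that each $h_i$ is $C^p$-partly smooth at $\tilde x_i$ for $\tilde v_i$ relative to some $C^p$ embedded submanifold of $\mathcal X_i$, where $\tilde v_i=\nabla h_i(\tilde x_i)$ for $i\in\mathcal I_1$ and $\tilde v_i=-\tilde z_i$ for $i\in\mathcal I_2$. Here a proper closed convex $h$ is $C^p$-partly smooth at $x\in\mathcal M$ for $v\in\partial h(x)$ relative to a $C^p$ embedded submanifold $\mathcal M$ if: (i) $h|_{\mathcal M}$ is $C^p$ near $x$; (ii) $h$ is prox-regular at $x$ for $v$; (iii) the linear subspace parallel to the affine hull of $\partial h(x)$ equals the normal space $N_{\mathcal M}(x)$; (iv) for some neighborhood $V$ of $v$ the set-valued map $V\cap\partial h$ is inner semicontinuous at $x$ relative to $\mathcal M$. Then for every $\sigma>0$ the function $\Phi$ is finite and differentiable everywhere (so that $F$ is well defined), and $F$ is $C^{p-1}$-smooth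 in a neighborhood of the point $\big((\tilde x_1,\dots,\tilde x_{n-1}),\tilde z\big)$. -/

import Mathlib

open Set Filter Topology

noncomputable section

section ConvexAnalysis

variable {E : Type*} [NormedAddCommGroup E] [InnerProductSpace ℝ E]

/-- The effective domain of an extended-real-valued function. -/
def effDom (h : E → EReal) : Set E := {x | h x ≠ ⊤}

/-- Proper, closed (lower semicontinuous), convex functions `E → (-∞, +∞]`. -/
structure IsProperClosedConvex (h : E → EReal) : Prop where
  ne_bot : ∀ x, h x ≠ ⊥
  exists_ne_top : ∃ x, h x ≠ ⊤
  closed : LowerSemicontinuous h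
  convex : Convex ℝ {q : E × ℝ | h q.1 ≤ (q.2 : EReal)}

/-- The convex subdifferential `∂h(x) = {v | h(y) ≥ h(x) + ⟨v, y - x⟩ for all y}`. For a proper
function it is empty outside the effective domain. -/
def subdiff (h : E → EReal) (x : E) : Set E :=
  {v | ∀ y, h x + ((inner ℝ v (y - x) : ℝ) : EReal) ≤ h y}

/-- `M` is an embedded `C^p` submanifold of `E`: it has a codimension `k`, and near each of its
points it is the zero set of a `C^p` map to `ℝ^k` whose derivative is surjective. -/
def IsEmbeddedSubmanifold (p : ℕ) (M : Set E) : Prop :=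
  ∃ k : ℕ, ∀ x ∈ M, ∃ (U : Set E) (G : E → EuclideanSpace ℝ (Fin k)),
    IsOpen U ∧ x ∈ U ∧ ContDiffOn ℝ p G U ∧
    (∀ y ∈ U, Function.Surjective (fderiv ℝ G y)) ∧
    M ∩ U = {y | y ∈ U ∧ G y = 0}

/-- Tangent vectors of `M` at `x`: velocities at time `0` of curves through `x` lying in `M`. -/
def tangentVectors (M : Set E) (x : E) : Set E :=
  {u | ∃ γ : ℝ → E, γ 0 = x ∧ (∀ᶠ t in 𝓝 (0 : ℝ), γ t ∈ M) ∧ HasDerivAt γ u 0}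

/-- The normal space of `M` at `x`: the orthogonal complement of the tangent space. -/
def normalSpace (M : Set E) (x : E) : Submodule ℝ E :=
  (Submodule.span ℝ (tangentVectors M x))ᗮ

/-- Prox-regularity of a closed convex function `h` at `x` for `v` (for such functions the
limiting subdifferential is `subdiff`, and local lower semicontinuity is automatic). -/
def IsProxRegularAt (h : E → EReal) (x v : E) : Prop :=
  h x ≠ ⊤ ∧ h x ≠ ⊥ ∧ v ∈ subdiff h x ∧
  ∃ ε > (0 : ℝ), ∃ ρ ≥ (0 : ℝ), ∀ x' x'' v'' : E,
    ‖x' - x‖ < ε → ‖x'' - x‖ < ε → h x'' < h x + (ε : EReal) →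
    v'' ∈ subdiff h x'' → ‖v'' - v‖ < ε →
    h x'' + ((inner ℝ v'' (x' - x'') - ρ / 2 * ‖x' - x''‖ ^ 2 : ℝ) : EReal) ≤ h x'

/-- `C^p`-partial smoothness of a proper closed convex function `h` at `x ∈ M` for `v ∈ ∂h(x)`
relative to the `C^p` embedded submanifold `M`. -/
structure IsPartlySmoothRel (p : ℕ) (h : E → EReal) (x v : E) (M : Set E) : Prop where
  submanifold : IsEmbeddedSubmanifold p M
  mem : x ∈ M
  mem_subdiff : v ∈ subdiff h x
  /-- the restriction of `h` to `M` is `C^p` near `x` -/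
  smooth : ∃ g : E → ℝ, ContDiffAt ℝ p g x ∧ ∀ᶠ y in 𝓝[M] x, h y = (g y : EReal)
  prox_regular : IsProxRegularAt h x v
  /-- `par ∂h(x) = N_M(x)` -/
  sharp : vectorSpan ℝ (subdiff h x) = normalSpace M x
  /-- inner semicontinuity at `x` relative to `M` of the localized subdifferential `V ∩ ∂h` -/
  inner_semicontinuous :
    ∃ V ∈ 𝓝 v, LowerHemicontinuousWithinAt (fun y => V ∩ subdiff h y) M x

/-- `h` is `C^p`-partly smooth at `x` for `v`, relative to some `C^p` embedded submanifold. -/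
def IsPartlySmoothAt (p : ℕ) (h : E → EReal) (x v : E) : Prop :=
  ∃ M : Set E, IsPartlySmoothRel p h x v M

/-- The gradient of a real-valued function on a finite-dimensional inner product space. -/
def grad [FiniteDimensional ℝ E] (f : E → ℝ) (x : E) : E :=
  haveI : CompleteSpace E := FiniteDimensional.complete ℝ E
  gradient f x

end ConvexAnalysis

/-- The space of primal variables `x = (x_1, …, x_{n-1})`, split into the blocks with smooth
terms (`X₁`) and those with possibly nonsmooth terms (`X₂`). -/
abbrev PrimalSpace {n₁ n₂ : ℕ} (X₁ : Fin n₁ → Type*) (X₂ : Fin n₂ → Type*) :=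
  WithLp 2 (PiLp 2 X₁ × PiLp 2 X₂)

/-- The space of multipliers `z = (z_{n₁+1}, …, z_{n-1}, z_n)`. -/
abbrev DualSpace {n₂ : ℕ} (X₂ : Fin n₂ → Type*) (Y : Type*) :=
  WithLp 2 (PiLp 2 X₂ × Y)

/-- The space of primal-dual variables `w = (x, z)`, with its Euclidean product structure. -/
abbrev PDSpace {n₁ n₂ : ℕ} (X₁ : Fin n₁ → Type*) (X₂ : Fin n₂ → Type*) (Y : Type*) :=
  WithLp 2 (PrimalSpace X₁ X₂ × DualSpace X₂ Y)

/-- Data of the linearly constrained multi-block convex composite problem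
`min ∑ h_i(x_i)  s.t.  ∑_{i<n} A_i x_i + x_n = b`  with `n = n₁ + n₂ + 1` blocks:
the first `n₁` blocks have smooth terms `h₁ i`, the next `n₂` blocks have proper closed convex
terms `h₂ j`, and the last block, which enters the constraint through the identity and so lives
in `Y`, has a proper closed convex term `hₙ`. -/
structure MultiBlockProblem {n₁ n₂ : ℕ} (X₁ : Fin n₁ → Type*) (X₂ : Fin n₂ → Type*) (Y : Type*)
    [∀ i, NormedAddCommGroup (X₁ i)] [∀ i, InnerProductSpace ℝ (X₁ i)]
    [∀ i, FiniteDimensional ℝ (X₁ i)]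
    [∀ j, NormedAddCommGroup (X₂ j)] [∀ j, InnerProductSpace ℝ (X₂ j)]
    [∀ j, FiniteDimensional ℝ (X₂ j)]
    [NormedAddCommGroup Y] [InnerProductSpace ℝ Y] [FiniteDimensional ℝ Y] where
  h₁ : ∀ i, X₁ i → ℝ
  h₂ : ∀ j, X₂ j → EReal
  hₙ : Y → EReal
  A₁ : ∀ i, X₁ i →ₗ[ℝ] Y
  A₂ : ∀ j, X₂ j →ₗ[ℝ] Y
  b : Y
  h₁_convex : ∀ i, ConvexOn ℝ univ (h₁ i)
  h₁_contDiff : ∀ i, ContDiff ℝ 2 (h₁ i)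
  h₁_grad_lipschitz : ∀ i, ∃ L, LipschitzWith L (grad (h₁ i))
  h₂_pcc : ∀ j, IsProperClosedConvex (h₂ j)
  hₙ_pcc : IsProperClosedConvex hₙ

namespace MultiBlockProblem

variable {n₁ n₂ : ℕ} {X₁ : Fin n₁ → Type*} {X₂ : Fin n₂ → Type*} {Y : Type*}
  [∀ i, NormedAddCommGroup (X₁ i)] [∀ i, InnerProductSpace ℝ (X₁ i)]
  [∀ i, FiniteDimensional ℝ (X₁ i)]
  [∀ j, NormedAddCommGroup (X₂ j)] [∀ j, InnerProductSpace ℝ (X₂ j)]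
  [∀ j, FiniteDimensional ℝ (X₂ j)]
  [NormedAddCommGroup Y] [InnerProductSpace ℝ Y] [FiniteDimensional ℝ Y]
  (P : MultiBlockProblem X₁ X₂ Y)

/-- A smooth term viewed as an extended-real-valued function. -/
def h₁E (i : Fin n₁) : X₁ i → EReal := fun x => (P.h₁ i x : EReal)

/-- `∑_{i<n} A_i x_i`. -/
def lin (x₁ : ∀ i, X₁ i) (x₂ : ∀ j, X₂ j) : Y :=
  ∑ i, P.A₁ i (x₁ i) + ∑ j, P.A₂ j (x₂ j)

/-- The linear constraint `∑_{i<n} A_i x_i + x_n = b`. -/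
def Feasible (x₁ : ∀ i, X₁ i) (x₂ : ∀ j, X₂ j) (xₙ : Y) : Prop :=
  P.lin x₁ x₂ + xₙ = P.b

/-- The objective `∑_i h_i(x_i)`. -/
def objective (x₁ : ∀ i, X₁ i) (x₂ : ∀ j, X₂ j) (xₙ : Y) : EReal :=
  ∑ i, P.h₁E i (x₁ i) + ∑ j, P.h₂ j (x₂ j) + P.hₙ xₙ

/-- Optimal solutions of the problem. -/
def IsOptimal (x₁ : ∀ i, X₁ i) (x₂ : ∀ j, X₂ j) (xₙ : Y) : Prop :=
  P.Feasible x₁ x₂ xₙ ∧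
  ∀ y₁ y₂ yₙ, P.Feasible y₁ y₂ yₙ → P.objective x₁ x₂ xₙ ≤ P.objective y₁ y₂ yₙ

/-- Slater's condition: a feasible point with `x_i ∈ ri (dom h_i)` for every block. -/
def Slater : Prop :=
  ∃ (x₁ : ∀ i, X₁ i) (x₂ : ∀ j, X₂ j) (xₙ : Y), P.Feasible x₁ x₂ xₙ ∧
    (∀ i, x₁ i ∈ intrinsicInterior ℝ (effDom (P.h₁E i))) ∧
    (∀ j, x₂ j ∈ intrinsicInterior ℝ (effDom (P.h₂ j))) ∧
    xₙ ∈ intrinsicInterior ℝ (effDom P.hₙ)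

/-- The augmented Lagrangian of the split problem
`min ∑ h₁ i (x_i) + ∑ h₂ j (y_j) + hₙ(x_n)  s.t.  ∑_{i<n} A_i x_i + x_n = b, x_j = y_j`
with penalty parameter `σ` and multipliers `z₂ j` (for `x_j = y_j`) and `zₙ`. -/
def augLagrangian (σ : ℝ) (x₁ : ∀ i, X₁ i) (x₂ : ∀ j, X₂ j) (xₙ : Y) (y : ∀ j, X₂ j)
    (z₂ : ∀ j, X₂ j) (zₙ : Y) : EReal :=
  ((∑ i, P.h₁ i (x₁ i) - 1 / (2 * σ) * (∑ j, ‖z₂ j‖ ^ 2 + ‖zₙ‖ ^ 2)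
      + σ / 2 * ‖P.lin x₁ x₂ + xₙ - P.b + σ⁻¹ • zₙ‖ ^ 2
      + σ / 2 * ∑ j, ‖x₂ j - y j - σ⁻¹ • z₂ j‖ ^ 2 : ℝ) : EReal)
    + (∑ j, P.h₂ j (y j) + P.hₙ xₙ)

/-- `Φ(x; z) = min_{y, x_n} L_σ(x, x_n, y; z)` as an extended real number. -/
def PhiE (σ : ℝ) (x : PrimalSpace X₁ X₂) (z : DualSpace X₂ Y) : EReal :=
  ⨅ (y : ∀ j, X₂ j) (xₙ : Y),
    P.augLagrangian σ (fun i => x.fst i) (fun j => x.snd j) xₙ y (fun j => z.fst j) z.snd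

/-- The real-valued saddle function `Φ(x; z)`. -/
def Phi (σ : ℝ) (x : PrimalSpace X₁ X₂) (z : DualSpace X₂ Y) : ℝ := (P.PhiE σ x z).toReal

/-- The residual map `F(w) = (∇_x Φ(w), -∇_z Φ(w))`, `w = (x, z)`. -/
def F (σ : ℝ) (w : PDSpace X₁ X₂ Y) : PDSpace X₁ X₂ Y :=
  WithLp.toLp 2 (grad (fun x => P.Phi σ x w.snd) w.fst, -grad (fun z => P.Phi σ w.fst z) w.snd)

/-- The Karush–Kuhn–Tucker system of the split problem for `(x, z)`, with the multipliers signed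
as in `augLagrangian` (whose Lagrangian terms are `+⟨zₙ, ∑ A_i x_i + x_n - b⟩` and
`-⟨z₂ j, x_j - y_j⟩`). -/
structure IsKKT (x₁ : ∀ i, X₁ i) (x₂ : ∀ j, X₂ j) (xₙ : Y) (z₂ : ∀ j, X₂ j) (zₙ : Y) :
    Prop where
  feasible : P.Feasible x₁ x₂ xₙ
  mem_subdiff₂ : ∀ j, -z₂ j ∈ subdiff (P.h₂ j) (x₂ j)
  mem_subdiffₙ : -zₙ ∈ subdiff P.hₙ xₙ
  stationary₁ : ∀ i, LinearMap.adjoint (P.A₁ i) zₙ + grad (P.h₁ i) (x₁ i) = 0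
  stationary₂ : ∀ j, LinearMap.adjoint (P.A₂ j) zₙ - z₂ j = 0

/-- Strict complementarity of a primal-dual pair. -/
def StrictCompl (x₂ : ∀ j, X₂ j) (xₙ : Y) (z₂ : ∀ j, X₂ j) (zₙ : Y) : Prop :=
  (∀ j, -z₂ j ∈ intrinsicInterior ℝ (subdiff (P.h₂ j) (x₂ j))) ∧
  -zₙ ∈ intrinsicInterior ℝ (subdiff P.hₙ xₙ)

/-- Partial smoothness of every `h_i` at `x_i` for the subgradient that the pair selects:
`∇h_i(x_i)` for the smooth blocks, minus the multiplier for the others. -/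
def PartlySmooth (p : ℕ) (x₁ : ∀ i, X₁ i) (x₂ : ∀ j, X₂ j) (xₙ : Y) (z₂ : ∀ j, X₂ j)
    (zₙ : Y) : Prop :=
  (∀ i, IsPartlySmoothAt p (P.h₁E i) (x₁ i) (grad (P.h₁ i) (x₁ i))) ∧
  (∀ j, IsPartlySmoothAt p (P.h₂ j) (x₂ j) (-z₂ j)) ∧
  IsPartlySmoothAt p P.hₙ xₙ (-zₙ)

end MultiBlockProblem

/-- The point `w = (x, z)` of the primal-dual space with the given blocks. -/
def pdPoint {n₁ n₂ : ℕ} {X₁ : Fin n₁ → Type*} {X₂ : Fin n₂ → Type*} {Y : Type*}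
    (x₁ : ∀ i, X₁ i) (x₂ : ∀ j, X₂ j) (z₂ : ∀ j, X₂ j) (zₙ : Y) : PDSpace X₁ X₂ Y :=
  WithLp.toLp 2 (WithLp.toLp 2 (WithLp.toLp 2 x₁, WithLp.toLp 2 x₂),
    WithLp.toLp 2 (WithLp.toLp 2 z₂, zₙ))

end

/-!
After the minimization over `(y, x_n)`, which separates over the blocks, `Φ` is the sum of the smooth
terms, a quadratic in `z` and the Moreau envelopes of the nonsmooth terms `h`, evaluated at points
depending affinely on `(x, z)` (`MultiBlockProblem.phiE_eq`). The KKT system supplies a subgradient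
of each `h`, hence an affine minorant, so each envelope is finite and attained at the proximal point
`prox u`, characterized by `σ (u - prox u) ∈ ∂h(prox u)`. The envelope is differentiable with
gradient `σ (u - prox u)`. This settles finiteness and differentiability of `Φ`, and reduces the
rest to showing that each proximal map is `C^{p-1}` near `u₀ = x + σ⁻¹ v`, where `v ∈ ri ∂h(x)`:
then `Φ` is `C^p` and `F`, built from its derivative, is `C^{p-1}`.

Let `φ : T → E` be a chart of the manifold `M` at `x` whose derivative at `0` is the inclusion of
the tangent space `T`, and let `h = g` on `M` with `g` of class `C^p`. The function
`t ↦ g(φ t) + σ/2 ‖φ t - u₀‖²` has a critical point at `0` with quadratic growth, by the subgradient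
inequality for `v`; its second derivative is therefore nondegenerate there, and the inverse function
theorem produces critical points `τ u` for `u` near `u₀`, of class `C^{p-1}` in `u`
(`exists_contDiffAt_critical_point`).

It remains to see that `φ (τ u)` is the proximal point of `u`, that is, that
`w = σ (u - φ (τ u))` is a subgradient of `h` at `φ (τ u)`. Criticality says that `w` differs from
all these subgradients by normal vectors. Were `w` not one of them, the unit vector from the nearest
subgradient to `w` would be almost normal to `M` at `x`. Strict complementarity and the sharpness
`par ∂h(x) = N_M(x)` give a ball of the normal space around `v` inside `∂h(x)`, and inner
semicontinuity carries it approximately to `∂h(φ (τ u))`, which therefore contains points beyond `w`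
in that direction, a contradiction (`mem_of_approximates_normal_ball`). The proximal points are thus found
on `M` directly, without first proving that the proximal map takes its values in `M`.

For a smooth term the subdifferential is a singleton, so sharpness forces the normal space to vanish
and `M` to be open; the term is then `C^p` near its point.
-/

noncomputable section

/-! ### Subgradients of proper closed convex functions -/

section Subgradients

variable {E : Type*} [NormedAddCommGroup E] [InnerProductSpace ℝ E] {h : E → EReal}

namespace IsProperClosedConvex

lemma ne_top_of_mem_subdiff (hh : IsProperClosedConvex h) {x v : E} (hv : v ∈ subdiff h x) :
    h x ≠ ⊤ := by
  intro hx
  obtain ⟨y, hy⟩ := hh.exists_ne_top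
  have := hv y
  rw [hx, EReal.top_add_coe, top_le_iff] at this
  exact hy this

lemma coe_toReal (hh : IsProperClosedConvex h) {x : E} (hx : h x ≠ ⊤) :
    ((h x).toReal : EReal) = h x :=
  EReal.coe_toReal hx (hh.ne_bot x)

lemma add_inner_le_toReal (hh : IsProperClosedConvex h) {x v y : E} (hv : v ∈ subdiff h x)
    (hy : h y ≠ ⊤) : (h x).toReal + inner ℝ v (y - x) ≤ (h y).toReal := by
  have := hv y
  rw [← hh.coe_toReal hy, ← hh.coe_toReal (hh.ne_top_of_mem_subdiff hv)] at this
  exact_mod_cast this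

lemma mem_subdiff_of_toReal (hh : IsProperClosedConvex h) {x v : E} (hx : h x ≠ ⊤)
    (H : ∀ y, h y ≠ ⊤ → (h x).toReal + inner ℝ v (y - x) ≤ (h y).toReal) :
    v ∈ subdiff h x := by
  intro y
  by_cases hy : h y = ⊤
  · simp [hy]
  · rw [← hh.coe_toReal hy, ← hh.coe_toReal hx]
    exact_mod_cast H y hy

lemma toReal_segment_le (hh : IsProperClosedConvex h) {x y : E} (hx : h x ≠ ⊤) (hy : h y ≠ ⊤)
    {t : ℝ} (h0 : 0 ≤ t) (h1 : t ≤ 1) :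
    h (x + t • (y - x)) ≠ ⊤ ∧
      (h (x + t • (y - x))).toReal ≤ (1 - t) * (h x).toReal + t * (h y).toReal := by
  have hmem := hh.convex (x := (x, (h x).toReal)) (y := (y, (h y).toReal))
    (by simp [hh.coe_toReal hx]) (by simp [hh.coe_toReal hy])
    (sub_nonneg.2 h1) h0 (by ring)
  have hle : h (x + t • (y - x)) ≤ (((1 - t) * (h x).toReal + t * (h y).toReal : ℝ) : EReal) := by
    have e : (1 - t) • x + t • y = x + t • (y - x) := by module
    simpa [e] using hmem
  have hne : h (x + t • (y - x)) ≠ ⊤ := fun H => by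
    rw [H, top_le_iff] at hle
    exact EReal.coe_ne_top _ hle
  refine ⟨hne, ?_⟩
  rw [← hh.coe_toReal hne] at hle
  exact_mod_cast hle

lemma convex_subdiff (hh : IsProperClosedConvex h) (x : E) : Convex ℝ (subdiff h x) := by
  intro v hv w hw a b ha hb hab
  refine hh.mem_subdiff_of_toReal (hh.ne_top_of_mem_subdiff hv) fun y hy => ?_
  have h1 := hh.add_inner_le_toReal hv hy
  have h2 := hh.add_inner_le_toReal hw hy
  rw [inner_add_left, real_inner_smul_left, real_inner_smul_left]
  obtain rfl : b = 1 - a := by linarith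
  nlinarith

lemma isClosed_subdiff (hh : IsProperClosedConvex h) (x : E) : IsClosed (subdiff h x) := by
  by_cases hx : h x = ⊤
  · convert isClosed_empty
    exact eq_empty_of_forall_notMem fun v hv => hh.ne_top_of_mem_subdiff hv hx
  have e : subdiff h x =
      ⋂ y, ⋂ (_ : h y ≠ ⊤), {v : E | (h x).toReal + inner ℝ v (y - x) ≤ (h y).toReal} := by
    ext v
    simp only [mem_iInter, mem_ofPred_eq]
    exact ⟨fun hv y hy => hh.add_inner_le_toReal hv hy, hh.mem_subdiff_of_toReal hx⟩
  rw [e]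
  exact isClosed_iInter fun y => isClosed_iInter fun _ =>
    isClosed_le (by fun_prop) continuous_const

/-- Monotonicity of the subdifferential. -/
lemma inner_sub_sub_nonneg (hh : IsProperClosedConvex h) {x y v w : E} (hv : v ∈ subdiff h x)
    (hw : w ∈ subdiff h y) : 0 ≤ inner ℝ (v - w) (x - y) := by
  have h1 := hh.add_inner_le_toReal hv (hh.ne_top_of_mem_subdiff hw)
  have h2 := hh.add_inner_le_toReal hw (hh.ne_top_of_mem_subdiff hv)
  rw [← neg_sub x y, inner_neg_right] at h1
  rw [inner_sub_left]
  linarith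

end IsProperClosedConvex

end Subgradients

/-! ### The proximal map and the Moreau envelope -/

section Moreau

variable {E : Type*} [NormedAddCommGroup E] [InnerProductSpace ℝ E] {h : E → EReal}

/-- A minimizer `m` of `h + σ/2 ‖u - ·‖²` satisfies the optimality condition
`σ (u - m) ∈ ∂h(m)`. -/
lemma IsProperClosedConvex.smul_sub_mem_subdiff_of_isMin (hh : IsProperClosedConvex h) {σ : ℝ}
    {u m : E} (hm : h m ≠ ⊤)
    (hmin : ∀ y, h y ≠ ⊤ →
      (h m).toReal + σ / 2 * ‖u - m‖ ^ 2 ≤ (h y).toReal + σ / 2 * ‖u - y‖ ^ 2) :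
    σ • (u - m) ∈ subdiff h m := by
  refine hh.mem_subdiff_of_toReal hm fun y hy => ?_
  -- compare `m` with the points `m + t (y - m)`, divide by `t` and let `t ↓ 0`
  have key : ∀ᶠ t in 𝓝[>] (0 : ℝ),
      (h m).toReal + σ * inner ℝ (u - m) (y - m) - (h y).toReal
        ≤ t * (σ / 2 * ‖y - m‖ ^ 2) := by
    filter_upwards [Ioo_mem_nhdsGT (zero_lt_one (α := ℝ))] with t ht
    obtain ⟨hne, hle⟩ := hh.toReal_segment_le hm hy ht.1.le ht.2.le
    have h1 := hmin _ hne
    have e : u - (m + t • (y - m)) = (u - m) - t • (y - m) := by abel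
    rw [e, norm_sub_sq_real (u - m), inner_smul_right, norm_smul, mul_pow, Real.norm_eq_abs,
      sq_abs] at h1
    have : t * ((h m).toReal + σ * inner ℝ (u - m) (y - m) - (h y).toReal)
        ≤ t * (t * (σ / 2 * ‖y - m‖ ^ 2)) := by nlinarith
    exact le_of_mul_le_mul_left this ht.1
  have lim : Tendsto (fun t : ℝ => t * (σ / 2 * ‖y - m‖ ^ 2)) (𝓝[>] 0) (𝓝 0) := by
    have : Tendsto (fun t : ℝ => t * (σ / 2 * ‖y - m‖ ^ 2)) (𝓝 0)
        (𝓝 (0 * (σ / 2 * ‖y - m‖ ^ 2))) :=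
      tendsto_id.mul_const _
    rw [zero_mul] at this
    exact this.mono_left nhdsWithin_le_nhds
  have := ge_of_tendsto lim key
  rw [real_inner_smul_left]
  linarith

/-- Existence of proximal points. A subgradient `v` at `x` bounds `h` below by an affine function,
so that the sublevel set of `h + σ/2 ‖u - ·‖²` through `x` lies in the ball around
`u - σ⁻¹ v` whose sphere passes through `x`. -/
lemma IsProperClosedConvex.exists_smul_sub_mem_subdiff [FiniteDimensional ℝ E]
    (hh : IsProperClosedConvex h) {σ : ℝ} (hσ : 0 < σ) {x v : E} (hv : v ∈ subdiff h x) (u : E) :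
    ∃ y, σ • (u - y) ∈ subdiff h y := by
  have : ProperSpace E := FiniteDimensional.proper ℝ E
  set c : E := u - σ⁻¹ • v
  set f : E → EReal := fun y => h y + ((σ / 2 * ‖u - y‖ ^ 2 : ℝ) : EReal)
  have hf : LowerSemicontinuous f := by
    refine hh.closed.add' (Continuous.lowerSemicontinuous ?_) fun y => ?_
    · exact continuous_coe_real_ereal.comp (by fun_prop)
    · exact EReal.continuousAt_add (Or.inr (EReal.coe_ne_bot _)) (Or.inl (hh.ne_bot y))
  have hfr : ∀ y, h y ≠ ⊤ → f y = (((h y).toReal + σ / 2 * ‖u - y‖ ^ 2 : ℝ) : EReal) := by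
    intro y hy
    rw [EReal.coe_add, hh.coe_toReal hy]
  have hx := hh.ne_top_of_mem_subdiff hv
  obtain ⟨m, -, hm⟩ := (hf.lowerSemicontinuousOn (Metric.closedBall c ‖x - c‖)).exists_isMinOn
    ⟨x, by simp [dist_eq_norm]⟩ (isCompact_closedBall _ _)
  have hmx : f m ≤ f x := hm (by simp [dist_eq_norm])
  have hmtop : h m ≠ ⊤ := fun H => by
    have : f m = ⊤ := by simp only [f, H, EReal.top_add_coe]
    rw [this, hfr x hx, top_le_iff] at hmx
    exact EReal.coe_ne_top _ hmx
  refine ⟨m, hh.smul_sub_mem_subdiff_of_isMin hmtop fun y hy => ?_⟩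
  have : f m ≤ f y := by
    by_cases hyc : y ∈ Metric.closedBall c ‖x - c‖
    · exact hm hyc
    refine hmx.trans ?_
    rw [hfr x hx, hfr y hy, EReal.coe_le_coe_iff]
    rw [Metric.mem_closedBall, dist_eq_norm, not_le] at hyc
    have h1 := hh.add_inner_le_toReal hv hy
    have h2 : ‖x - c‖ ^ 2 < ‖y - c‖ ^ 2 := by gcongr
    have e : ∀ w : E, σ / 2 * ‖w - c‖ ^ 2 =
        σ / 2 * ‖u - w‖ ^ 2 + inner ℝ v (w - u) + σ⁻¹ / 2 * ‖v‖ ^ 2 := by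
      intro w
      have : w - c = (w - u) + σ⁻¹ • v := by simp only [c]; abel
      rw [this, norm_add_sq_real, inner_smul_right, norm_smul, mul_pow, norm_sub_rev u w,
        Real.norm_eq_abs, sq_abs, real_inner_comm]
      field_simp
    have h3 := e x
    have h4 := e y
    have h5 : inner ℝ v (y - x) = inner ℝ v (y - u) - inner ℝ v (x - u) := by
      rw [← inner_sub_right]; congr 1; abel
    nlinarith
  rw [hfr m hmtop, hfr y hy, EReal.coe_le_coe_iff] at this
  exact this

open Classical in
/-- The proximal point of `h` at `u` with parameter `σ`: the point `y` with
`σ (u - y) ∈ ∂h(y)`, equivalently the minimizer of `h + σ/2 ‖u - ·‖²`. It is set to `0` if there is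
no such point. -/
def proxPoint (h : E → EReal) (σ : ℝ) (u : E) : E :=
  if H : ∃ y, σ • (u - y) ∈ subdiff h y then H.choose else 0

/-- The Moreau envelope `inf_y h(y) + σ/2 ‖u - y‖²`, defined through its value at the proximal
point. -/
def moreauEnv (h : E → EReal) (σ : ℝ) (u : E) : ℝ :=
  (h (proxPoint h σ u)).toReal + σ / 2 * ‖u - proxPoint h σ u‖ ^ 2

namespace IsProperClosedConvex

variable {σ : ℝ}

lemma proxPoint_mem [FiniteDimensional ℝ E] (hh : IsProperClosedConvex h) (hσ : 0 < σ) {x v : E}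
    (hv : v ∈ subdiff h x) (u : E) :
    σ • (u - proxPoint h σ u) ∈ subdiff h (proxPoint h σ u) := by
  have H := hh.exists_smul_sub_mem_subdiff hσ hv u
  rw [proxPoint, dif_pos H]
  exact H.choose_spec

lemma proxPoint_eq (hh : IsProperClosedConvex h) (hσ : 0 < σ) {u y : E}
    (hy : σ • (u - y) ∈ subdiff h y) : proxPoint h σ u = y := by
  have H : ∃ y, σ • (u - y) ∈ subdiff h y := ⟨y, hy⟩
  have hp : σ • (u - proxPoint h σ u) ∈ subdiff h (proxPoint h σ u) := by
    rw [proxPoint, dif_pos H]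
    exact H.choose_spec
  have h1 := hh.inner_sub_sub_nonneg hp hy
  have e : σ • (u - proxPoint h σ u) - σ • (u - y) = (-σ) • (proxPoint h σ u - y) := by module
  rw [e, real_inner_smul_left, real_inner_self_eq_norm_sq] at h1
  have h2 : ‖proxPoint h σ u - y‖ ^ 2 = 0 := by nlinarith [sq_nonneg ‖proxPoint h σ u - y‖]
  exact sub_eq_zero.1 (norm_eq_zero.1 (pow_eq_zero_iff two_ne_zero |>.1 h2))

variable [FiniteDimensional ℝ E]

lemma moreauEnv_le (hh : IsProperClosedConvex h) (hσ : 0 < σ) {x v : E}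
    (hv : v ∈ subdiff h x) (u y : E) :
    (moreauEnv h σ u : EReal) ≤ h y + ((σ / 2 * ‖u - y‖ ^ 2 : ℝ) : EReal) := by
  by_cases hy : h y = ⊤
  · rw [hy, EReal.top_add_coe]
    exact le_top
  rw [← hh.coe_toReal hy, ← EReal.coe_add, EReal.coe_le_coe_iff, moreauEnv]
  set q := proxPoint h σ u
  have h1 := hh.add_inner_le_toReal (hh.proxPoint_mem hσ hv u) hy
  have e : u - y = (u - q) - (y - q) := by abel
  rw [e, norm_sub_sq_real (u - q)]
  rw [real_inner_smul_left] at h1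
  nlinarith [sq_nonneg ‖y - q‖]

lemma coe_moreauEnv (hh : IsProperClosedConvex h) (hσ : 0 < σ) {x v : E}
    (hv : v ∈ subdiff h x) (u : E) :
    (moreauEnv h σ u : EReal) =
      h (proxPoint h σ u) + ((σ / 2 * ‖u - proxPoint h σ u‖ ^ 2 : ℝ) : EReal) := by
  rw [moreauEnv, EReal.coe_add,
    hh.coe_toReal (hh.ne_top_of_mem_subdiff (hh.proxPoint_mem hσ hv u))]

/-- The Moreau envelope lies between its linearization at `u` (it is convex) and that
linearization plus `σ/2 ‖u' - u‖²` (the competitor `proxPoint h σ u` in the infimum at `u'`). -/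
lemma abs_moreauEnv_sub_le (hh : IsProperClosedConvex h) (hσ : 0 < σ) {x v : E}
    (hv : v ∈ subdiff h x) (u u' : E) :
    |moreauEnv h σ u' - moreauEnv h σ u - inner ℝ (σ • (u - proxPoint h σ u)) (u' - u)|
      ≤ σ / 2 * ‖u' - u‖ ^ 2 := by
  have hq := hh.proxPoint_mem hσ hv u
  have hq' := hh.proxPoint_mem hσ hv u'
  have upper := hh.moreauEnv_le hσ hv u' (proxPoint h σ u)
  rw [← hh.coe_toReal (hh.ne_top_of_mem_subdiff hq), ← EReal.coe_add,
    EReal.coe_le_coe_iff] at upper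
  have lower := hh.add_inner_le_toReal hq (hh.ne_top_of_mem_subdiff hq')
  have eu : moreauEnv h σ u = (h (proxPoint h σ u)).toReal
    + σ / 2 * ‖u - proxPoint h σ u‖ ^ 2 := rfl
  have eu' : moreauEnv h σ u' = (h (proxPoint h σ u')).toReal
    + σ / 2 * ‖u' - proxPoint h σ u'‖ ^ 2 := rfl
  generalize proxPoint h σ u = q at *
  generalize proxPoint h σ u' = q' at *
  rw [real_inner_smul_left] at lower ⊢
  have e1 : ‖u' - q‖ ^ 2 = ‖u' - u‖ ^ 2 + 2 * inner ℝ (u - q) (u' - u) + ‖u - q‖ ^ 2 := by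
    have : u' - q = (u' - u) + (u - q) := by abel
    rw [this, norm_add_sq_real, real_inner_comm]
  have e2 : inner ℝ (u - q) (q' - q) =
      inner ℝ (u - q) (u' - u) + ‖u - q‖ ^ 2 - inner ℝ (u - q) (u' - q') := by
    have : q' - q = (u' - u) + (u - q) - (u' - q') := by abel
    rw [this, inner_sub_right, inner_add_right, real_inner_self_eq_norm_sq]
  have e3 := norm_sub_sq_real (u - q) (u' - q')
  have e4 := sq_nonneg ‖u - q - (u' - q')‖
  rw [abs_le]
  constructor <;> nlinarith [sq_nonneg ‖u' - u‖]

lemma hasFDerivAt_moreauEnv (hh : IsProperClosedConvex h) (hσ : 0 < σ) {x v : E}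
    (hv : v ∈ subdiff h x) (u : E) :
    HasFDerivAt (moreauEnv h σ) (innerSL ℝ (σ • (u - proxPoint h σ u))) u := by
  refine HasFDerivAt.of_isLittleO ?_
  have hO : (fun u' => moreauEnv h σ u' - moreauEnv h σ u -
      innerSL ℝ (σ • (u - proxPoint h σ u)) (u' - u)) =O[𝓝 u] fun u' => ‖u' - u‖ ^ 2 := by
    refine Asymptotics.IsBigO.of_bound (σ / 2) (Eventually.of_forall fun u' => ?_)
    rw [Real.norm_eq_abs, Real.norm_eq_abs, abs_of_nonneg (sq_nonneg ‖u' - u‖)]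
    exact hh.abs_moreauEnv_sub_le hσ hv u u'
  exact hO.trans_isLittleO (Asymptotics.isLittleO_pow_sub_sub u one_lt_two)

/-- The gradient of the envelope is `σ (u - prox u)`, so the envelope gains one degree of
smoothness over any map that selects proximal points. -/
lemma contDiffAt_moreauEnv (hh : IsProperClosedConvex h) (hσ : 0 < σ) {k : ℕ} {u : E}
    {Y : E → E} (hY : ContDiffAt ℝ k Y u)
    (hmem : ∀ᶠ u' in 𝓝 u, σ • (u' - Y u') ∈ subdiff h (Y u')) :
    ContDiffAt ℝ (k + 1) (moreauEnv h σ) u := by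
  refine contDiffAt_succ_iff_hasFDerivAt.2
    ⟨fun u' => innerSL ℝ (σ • (u' - proxPoint h σ u')),
      ⟨univ, univ_mem, fun u' _ => hh.hasFDerivAt_moreauEnv hσ hmem.self_of_nhds u'⟩, ?_⟩
  have : (fun u' => innerSL ℝ (σ • (u' - proxPoint h σ u')))
      =ᶠ[𝓝 u] fun u' => innerSL ℝ (σ • (u' - Y u')) := by
    filter_upwards [hmem] with u' hu'
    rw [hh.proxPoint_eq hσ hu']
  refine ContDiffAt.congr_of_eventuallyEq ?_ this
  exact (innerSL ℝ).contDiff.contDiffAt.comp u ((contDiffAt_id.sub hY).const_smul σ)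

end IsProperClosedConvex

end Moreau

/-! ### Local charts of embedded submanifolds -/

section Charts

/-- The inverse function theorem for a map whose derivative is bijective, with the local inverse
and its derivative described only by what characterizes them. -/
lemma ContDiffAt.exists_local_right_inverse {A B : Type*} [NormedAddCommGroup A] [NormedSpace ℝ A]
    [CompleteSpace A] [NormedAddCommGroup B] [NormedSpace ℝ B] [CompleteSpace B]
    {n : WithTop ℕ∞} (hn : n ≠ 0) {f : A → B} {f' : A →L[ℝ] B} {a : A}
    (hf : ContDiffAt ℝ n f a) (hf' : HasFDerivAt f f' a) (hbij : Function.Bijective f') :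
    ∃ Ψ : B → A, Ψ (f a) = a ∧ ContDiffAt ℝ n Ψ (f a) ∧ (∀ᶠ y in 𝓝 (f a), f (Ψ y) = y) ∧
      ∃ Ψ' : B →L[ℝ] A, HasFDerivAt Ψ Ψ' (f a) ∧ ∀ x, Ψ' (f' x) = x := by
  set e : A ≃L[ℝ] B := ContinuousLinearEquiv.ofBijective f'
    (LinearMap.ker_eq_bot.2 hbij.1) (LinearMap.range_eq_top.2 hbij.2)
  have he : HasFDerivAt f (e : A →L[ℝ] B) a := hf'
  have hs := hf.hasStrictFDerivAt' he hn
  exact ⟨hf.localInverse he hn, hf.localInverse_apply_image he hn, hf.to_localInverse he hn,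
    hs.eventually_right_inverse, (e.symm : B →L[ℝ] A), hs.to_localInverse.hasFDerivAt,
    fun x => e.symm_apply_apply x⟩

variable {E : Type*} [NormedAddCommGroup E] [InnerProductSpace ℝ E] {M U : Set E} {x : E}

lemma tangentVectors_subset_ker {F : Type*} [NormedAddCommGroup F] [NormedSpace ℝ F] {G : E → F}
    (hU : U ∈ 𝓝 x) (hG : DifferentiableAt ℝ G x) (hGM : ∀ y ∈ M ∩ U, G y = 0) :
    tangentVectors M x ⊆ (fderiv ℝ G x).ker := by
  rintro u ⟨γ, rfl, hM, hγ⟩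
  have h1 : HasDerivAt (G ∘ γ) (fderiv ℝ G (γ 0) u) 0 := hG.hasFDerivAt.comp_hasDerivAt 0 hγ
  have h2 : G ∘ γ =ᶠ[𝓝 0] fun _ => (0 : F) := by
    filter_upwards [hM, hγ.continuousAt hU] with t ht ht'
    exact hGM _ ⟨ht, ht'⟩
  exact h1.unique ((hasDerivAt_const (0 : ℝ) (0 : F)).congr_of_eventuallyEq h2)

lemma orthogonal_ker_le_normalSpace {F : Type*} [NormedAddCommGroup F] [NormedSpace ℝ F]
    {G : E → F} (hU : U ∈ 𝓝 x) (hG : DifferentiableAt ℝ G x) (hGM : ∀ y ∈ M ∩ U, G y = 0) :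
    (fderiv ℝ G x).kerᗮ ≤ normalSpace M x :=
  Submodule.orthogonal_le (Submodule.span_le.2 (tangentVectors_subset_ker hU hG hGM))

namespace IsEmbeddedSubmanifold

variable [FiniteDimensional ℝ E] {p : ℕ}

/-- A chart of an embedded submanifold around `x`, parametrized by a subspace `T` of the ambient
space whose inclusion is its derivative at `0`. Only the inclusion of `Tᗮ` in the normal space
is recorded; it is an equality. -/
lemma exists_chart (hM : IsEmbeddedSubmanifold p M) (hp : p ≠ 0) (hx : x ∈ M) :
    ∃ (T : Submodule ℝ E) (φ : T → E), φ 0 = x ∧ ContDiffAt ℝ p φ 0 ∧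
      HasFDerivAt φ T.subtypeL 0 ∧ (∀ᶠ t in 𝓝 0, φ t ∈ M) ∧ Tᗮ ≤ normalSpace M x := by
  have hp' : (p : WithTop ℕ∞) ≠ 0 := by exact_mod_cast hp
  obtain ⟨k, hk⟩ := hM
  obtain ⟨U, G, hUo, hxU, hG, hsurj, hMU⟩ := hk x hx
  have hU := hUo.mem_nhds hxU
  have hGx : ContDiffAt ℝ p G x := hG.contDiffAt hU
  have hGd : DifferentiableAt ℝ G x := hGx.differentiableAt hp'
  have hG0 : G x = 0 := ((Set.ext_iff.1 hMU x).1 ⟨hx, hxU⟩).2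
  set T : Submodule ℝ E := (fderiv ℝ G x).ker
  -- `y ↦ (G y, projection of y - x to T)` straightens `M`
  set Q : E → EuclideanSpace ℝ (Fin k) × T := fun y => (G y, T.orthogonalProjectionOnto (y - x))
  set Q' : E →L[ℝ] EuclideanSpace ℝ (Fin k) × T := (fderiv ℝ G x).prod T.orthogonalProjectionOnto
  have hQ : ContDiffAt ℝ p Q x := by
    refine hGx.prodMk ?_
    exact T.orthogonalProjectionOnto.contDiff.contDiffAt.comp x (contDiffAt_id.sub contDiffAt_const)
  have hQ' : HasFDerivAt Q Q' x := by
    refine hGd.hasFDerivAt.prodMk ?_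
    exact T.orthogonalProjectionOnto.hasFDerivAt.comp x ((hasFDerivAt_id x).sub_const x)
  have hbij : Function.Bijective Q' := by
    constructor
    · refine (injective_iff_map_eq_zero Q').2 fun z hz => ?_
      have h1 : z ∈ T := congrArg Prod.fst hz
      have h2 : T.orthogonalProjectionOnto z = 0 := congrArg Prod.snd hz
      have h3 := Submodule.orthogonalProjectionOnto_mem_subspace_eq_self (K := T) ⟨z, h1⟩
      rw [h2] at h3
      exact (congrArg Subtype.val h3).symm
    · rintro ⟨a, τ⟩
      obtain ⟨z, hz⟩ := hsurj x hxU a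
      have hT : ∀ w : T, fderiv ℝ G x w = 0 := fun w => w.2
      refine ⟨z - T.orthogonalProjectionOnto z + τ, Prod.ext ?_ ?_⟩
      · change fderiv ℝ G x _ = a
        rw [map_add, map_sub, hT, hT, hz, sub_zero, add_zero]
      · change T.orthogonalProjectionOnto _ = τ
        rw [map_add, map_sub, Submodule.orthogonalProjectionOnto_mem_subspace_eq_self,
          Submodule.orthogonalProjectionOnto_mem_subspace_eq_self, sub_self, zero_add]
  obtain ⟨Ψ, hΨ0, hΨ, hright, Ψ', hΨ', hinv⟩ :=
    hQ.exists_local_right_inverse hp' hQ' hbij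
  have hQx : Q x = (0, 0) := by simp [Q, hG0]
  rw [hQx] at hΨ0 hΨ hright hΨ'
  have hΨc : ContinuousAt (fun t : T => Ψ (0, t)) 0 :=
    ContinuousAt.comp (f := fun t : T => ((0 : EuclideanSpace ℝ (Fin k)), t)) hΨ.continuousAt
      (by fun_prop)
  refine ⟨T, fun t => Ψ (0, t), hΨ0, ?_, ?_, ?_, ?_⟩
  · exact ContDiffAt.comp (f := fun t : T => ((0 : EuclideanSpace ℝ (Fin k)), t)) 0 hΨ
      (contDiffAt_const.prodMk contDiffAt_id)
  · have h1 := HasFDerivAt.comp (f := fun t : T => ((0 : EuclideanSpace ℝ (Fin k)), t)) 0 hΨ'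
      ((hasFDerivAt_const _ _).prodMk (hasFDerivAt_id _))
    refine h1.congr_fderiv ?_
    ext τ
    have h2 : Q' τ = (0, τ) :=
      Prod.ext τ.2 (Submodule.orthogonalProjectionOnto_mem_subspace_eq_self τ)
    have h3 := hinv τ
    rw [h2] at h3
    exact h3
  · have hc : Tendsto (fun t : T => ((0 : EuclideanSpace ℝ (Fin k)), t)) (𝓝 0) (𝓝 (0, 0)) :=
      (by fun_prop : Continuous fun t : T => ((0 : EuclideanSpace ℝ (Fin k)), t)).tendsto 0
    have hUΨ : U ∈ 𝓝 (Ψ (0, 0)) := by rwa [hΨ0]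
    filter_upwards [hc.eventually hright, hΨc hUΨ] with t ht htU
    exact ((Set.ext_iff.1 hMU _).2 ⟨htU, congrArg Prod.fst ht⟩).1
  · exact orthogonal_ker_le_normalSpace hU hGd fun y hy => ((Set.ext_iff.1 hMU y).1 hy).2

/-- An embedded submanifold with trivial normal space at `x` has codimension `0`, hence contains a
neighbourhood of `x`. -/
lemma mem_nhds_of_normalSpace_eq_bot (hM : IsEmbeddedSubmanifold p M) (hp : p ≠ 0) (hx : x ∈ M)
    (hN : normalSpace M x = ⊥) : M ∈ 𝓝 x := by
  have hp' : (p : WithTop ℕ∞) ≠ 0 := by exact_mod_cast hp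
  obtain ⟨k, hk⟩ := hM
  obtain ⟨U, G, hUo, hxU, hG, hsurj, hMU⟩ := hk x hx
  have hU := hUo.mem_nhds hxU
  have hker := orthogonal_ker_le_normalSpace hU ((hG.contDiffAt hU).differentiableAt hp')
    fun y hy => ((Set.ext_iff.1 hMU y).1 hy).2
  rw [hN, le_bot_iff, Submodule.orthogonal_eq_bot_iff] at hker
  have hzero : ∀ a : EuclideanSpace ℝ (Fin k), a = 0 := by
    intro a
    obtain ⟨z, rfl⟩ := hsurj x hxU a
    have hz : z ∈ (fderiv ℝ G x).ker := hker ▸ Submodule.mem_top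
    exact hz
  filter_upwards [hU] with y hy
  exact ((Set.ext_iff.1 hMU y).2 ⟨hy, hzero _⟩).1

end IsEmbeddedSubmanifold

end Charts

/-! ### Critical points of a perturbed function in a chart -/

section CriticalPoints

/-- Quadratic growth at a point bounds the second derivative from below. -/
lemma two_mul_le_deriv_of_quadratic_growth {f f' : ℝ → ℝ} {a c : ℝ}
    (hf : ∀ᶠ s in 𝓝 0, HasDerivAt f (f' s) s) (hf' : HasDerivAt f' a 0)
    (hg : ∀ᶠ s in 𝓝 0, f 0 + c * s ^ 2 ≤ f s) : 2 * c ≤ a := by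
  by_contra! hlt
  set q : ℝ → ℝ := fun s => f s - c * s ^ 2
  have hq : ∀ᶠ s in 𝓝 0, HasDerivAt q (f' s - c * (2 * s)) s := by
    filter_upwards [hf] with s hs
    exact hs.sub ((by simpa using hasDerivAt_pow 2 s : HasDerivAt (· ^ 2) (2 * s) s).const_mul c)
  have hmin : IsLocalMin q 0 := by
    filter_upwards [hg] with s hs
    simp only [q]
    linarith
  have hd : deriv q =ᶠ[𝓝 0] fun s => f' s - c * (2 * s) := hq.mono fun s hs => hs.deriv
  have hdd : deriv (deriv q) 0 = a - c * 2 := by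
    rw [hd.deriv_eq]
    refine (hf'.sub (HasDerivAt.const_mul c ?_)).deriv
    simpa using (hasDerivAt_id (0 : ℝ)).const_mul 2
  have hmax : IsLocalMax q 0 :=
    isLocalMax_of_deriv_deriv_neg (by rw [hdd]; linarith) hmin.deriv_eq_zero
      hq.self_of_nhds.continuousAt
  -- a point that is both a local minimum and a local maximum has vanishing second derivative
  have hconst : q =ᶠ[𝓝 0] fun _ => q 0 := by
    filter_upwards [hmin, hmax] with s h1 h2
    exact le_antisymm h2 h1
  have : deriv (deriv q) 0 = 0 := by
    rw [hconst.deriv.deriv_eq]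
    simp
  linarith

variable {T E : Type*} [NormedAddCommGroup T] [NormedSpace ℝ T] [FiniteDimensional ℝ T]
  [NormedAddCommGroup E] [InnerProductSpace ℝ E] [FiniteDimensional ℝ E]

/-- If `m - ⟨v, φ⟩` has a local minimum at `0` and `φ` is an immersion at `0`, the functions
`m + σ/2 ‖φ - u‖²` with `u` near `φ 0 + σ⁻¹ v` have critical points `τ u` that depend smoothly
on `u`: the case `u = φ 0 + σ⁻¹ v` has quadratic growth at `0`, which makes the derivative of the
criticality equation in `t` invertible there. -/
lemma exists_contDiffAt_critical_point {σ : ℝ} (hσ : 0 < σ) {k : ℕ} (hk : k ≠ 0) {m : T → ℝ}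
    {φ : T → E} {v : E} (hm : ContDiffAt ℝ (k + 1) m 0) (hφ : ContDiffAt ℝ (k + 1) φ 0)
    (himm : Function.Injective (fderiv ℝ φ 0))
    (hmin : ∀ᶠ t in 𝓝 0, m 0 + inner ℝ v (φ t - φ 0) ≤ m t) :
    ∃ τ : E → T, τ (φ 0 + σ⁻¹ • v) = 0 ∧ ContDiffAt ℝ k τ (φ 0 + σ⁻¹ • v) ∧
      ∀ᶠ u in 𝓝 (φ 0 + σ⁻¹ • v), ∀ a,
        fderiv ℝ m (τ u) a = inner ℝ (σ • (u - φ (τ u))) (fderiv ℝ φ (τ u) a) := by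
  have hk' : (k : WithTop ℕ∞) ≠ 0 := by exact_mod_cast hk
  set u₀ : E := φ 0 + σ⁻¹ • v
  have hk1 : ((k : WithTop ℕ∞) + 1) ≠ 0 := by exact_mod_cast Nat.succ_ne_zero k
  set Θ : T × E → T →L[ℝ] ℝ := fun w =>
    fderiv ℝ m w.1 - (innerSL ℝ (σ • (w.2 - φ w.1))).comp (fderiv ℝ φ w.1)
  have hΘ : ContDiffAt ℝ k Θ (0, u₀) := by
    have h1 : ContDiffAt ℝ k (fun w : T × E => fderiv ℝ m w.1) (0, u₀) :=
      ContDiffAt.comp (0, u₀) (hm.fderiv_right le_rfl : ContDiffAt ℝ k (fderiv ℝ m) 0)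
        contDiffAt_fst
    have h2 : ContDiffAt ℝ k (fun w : T × E => fderiv ℝ φ w.1) (0, u₀) :=
      ContDiffAt.comp (0, u₀) (hφ.fderiv_right le_rfl : ContDiffAt ℝ k (fderiv ℝ φ) 0)
        contDiffAt_fst
    have h3 : ContDiffAt ℝ k (fun w : T × E => φ w.1) (0, u₀) :=
      ContDiffAt.comp (0, u₀) (hφ.of_le (by exact_mod_cast Nat.le_succ k)) contDiffAt_fst
    refine h1.sub (ContDiffAt.clm_comp ?_ h2)
    exact (innerSL ℝ).contDiff.contDiffAt.comp _ ((contDiffAt_snd.sub h3).const_smul σ)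
  have hΘd := (hΘ.differentiableAt hk').hasFDerivAt
  -- the restriction of `m + σ/2 ‖φ - u₀‖²` to the line through `0` in direction `a`
  set f : T → ℝ → ℝ := fun a s => m (s • a) + σ / 2 * ‖φ (s • a) - u₀‖ ^ 2
  have hline : ∀ a : T, Tendsto (fun s : ℝ => s • a) (𝓝 0) (𝓝 0) := fun a => by
    have : Continuous fun s : ℝ => s • a := by fun_prop
    simpa using this.tendsto 0
  have hlineD : ∀ (a : T) (s : ℝ), HasDerivAt (fun s : ℝ => s • a) a s := fun a s => by
    simpa using (hasDerivAt_id s).smul_const a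
  have hfd : ∀ a, ∀ᶠ s in 𝓝 (0 : ℝ), HasDerivAt (f a) (Θ (s • a, u₀) a) s := by
    intro a
    have hm' : ∀ᶠ t in 𝓝 (0 : T), DifferentiableAt ℝ m t :=
      ((hm.of_le (by exact_mod_cast Nat.one_le_iff_ne_zero.2 (Nat.succ_ne_zero k)) :
        ContDiffAt ℝ 1 m 0).eventually (by simp)).mono fun t ht => ht.differentiableAt one_ne_zero
    have hφ' : ∀ᶠ t in 𝓝 (0 : T), DifferentiableAt ℝ φ t :=
      ((hφ.of_le (by exact_mod_cast Nat.one_le_iff_ne_zero.2 (Nat.succ_ne_zero k)) :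
        ContDiffAt ℝ 1 φ 0).eventually (by simp)).mono fun t ht => ht.differentiableAt one_ne_zero
    filter_upwards [(hline a).eventually hm', (hline a).eventually hφ'] with s h1 h2
    have d1 := h1.hasFDerivAt.comp_hasDerivAt s (hlineD a s)
    have d2 := h2.hasFDerivAt.comp_hasDerivAt s (hlineD a s)
    have d3 := d1.add (((d2.sub_const u₀).norm_sq).const_mul (σ / 2))
    refine d3.congr_deriv ?_
    simp only [Θ, Function.comp_apply, sub_apply,
      ContinuousLinearMap.comp_apply, innerSL_apply_apply, real_inner_smul_left]
    rw [← neg_sub u₀, inner_neg_left]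
    ring
  have hgrow : ∀ a, ∀ᶠ s in 𝓝 (0 : ℝ), f a 0 + σ / 2 * ‖φ (s • a) - φ 0‖ ^ 2 ≤ f a s := by
    intro a
    filter_upwards [(hline a).eventually hmin] with s hs
    simp only [f, zero_smul]
    have e1 : ‖φ 0 - u₀‖ ^ 2 = ‖σ⁻¹ • v‖ ^ 2 := by
      rw [norm_sub_rev]; congr 2; simp only [u₀]; abel
    have e2 : φ (s • a) - u₀ = (φ (s • a) - φ 0) - σ⁻¹ • v := by simp only [u₀]; abel
    rw [e1, e2, norm_sub_sq_real (φ (s • a) - φ 0), inner_smul_right, real_inner_comm]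
    have : σ / 2 * (2 * (σ⁻¹ * inner ℝ v (φ (s • a) - φ 0))) = inner ℝ v (φ (s • a) - φ 0) := by
      field_simp
    linarith
  have hΘ0 : Θ (0, u₀) = 0 := by
    ext a
    have h1 : HasDerivAt (f a) (Θ (0, u₀) a) 0 := by simpa using (hfd a).self_of_nhds
    have h2 : IsLocalMin (f a) 0 := by
      filter_upwards [hgrow a] with s hs
      have := mul_nonneg (half_pos hσ).le (sq_nonneg ‖φ (s • a) - φ 0‖)
      linarith
    exact h2.hasDerivAt_eq_zero h1
  have hinj : ∀ a, fderiv ℝ Θ (0, u₀) (a, 0) = 0 → a = 0 := by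
    intro a ha
    by_contra hane
    set ι := fderiv ℝ φ 0
    have hι : 0 < ‖ι a‖ := norm_pos_iff.2 fun H => hane (himm (by rw [H, map_zero]))
    have hφd : HasDerivAt (fun s : ℝ => φ (s • a)) (ι a) 0 := by
      refine HasFDerivAt.comp_hasDerivAt (l := φ) (0 : ℝ) ?_ (hlineD a 0)
      rw [zero_smul]
      exact (hφ.differentiableAt hk1).hasFDerivAt
    have hquad : ∀ᶠ s in 𝓝 (0 : ℝ), f a 0 + σ / 8 * ‖ι a‖ ^ 2 * s ^ 2 ≤ f a s := by
      have hlo := (hasDerivAt_iff_isLittleO.1 hφd).def (half_pos hι)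
      filter_upwards [hgrow a, hlo] with s hs hlo
      rw [sub_zero, zero_smul, Real.norm_eq_abs] at hlo
      have h1 : |s| * ‖ι a‖ ≤ ‖φ (s • a) - φ 0‖ + ‖ι a‖ / 2 * |s| := by
        rw [← Real.norm_eq_abs, ← norm_smul, Real.norm_eq_abs]
        refine le_trans ?_ (add_le_add_right hlo _)
        have := norm_sub_le (φ (s • a) - φ 0) (φ (s • a) - φ 0 - s • ι a)
        rwa [sub_sub_cancel] at this
      have h2 : |s| * ‖ι a‖ / 2 ≤ ‖φ (s • a) - φ 0‖ := by linarith
      have h3 : (|s| * ‖ι a‖ / 2) ^ 2 ≤ ‖φ (s • a) - φ 0‖ ^ 2 := by gcongr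
      rw [div_pow, mul_pow, sq_abs] at h3
      nlinarith
    have hΘline : HasDerivAt (fun s : ℝ => Θ (s • a, u₀) a) 0 0 := by
      have h1 : HasDerivAt (fun s : ℝ => (s • a, u₀)) (a, 0) 0 :=
        (hlineD a 0).prodMk (hasDerivAt_const 0 u₀)
      have h2 : HasDerivAt (fun s : ℝ => Θ (s • a, u₀)) (fderiv ℝ Θ (0, u₀) (a, 0)) 0 := by
        refine HasFDerivAt.comp_hasDerivAt (l := Θ) (0 : ℝ) ?_ h1
        rw [zero_smul]
        exact hΘd
      rw [ha] at h2
      simpa using h2.clm_apply (hasDerivAt_const 0 a)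
    have := two_mul_le_deriv_of_quadratic_growth (hfd a) hΘline hquad
    have : 0 < σ / 8 * ‖ι a‖ ^ 2 := by positivity
    linarith
  -- solve `Θ (t, u) = 0` for `t` by inverting `(t, u) ↦ (Θ (t, u), u)`
  set S : T × E → (T →L[ℝ] ℝ) × E := fun w => (Θ w, w.2)
  have hS : ContDiffAt ℝ k S (0, u₀) := hΘ.prodMk contDiffAt_snd
  have hS' : HasFDerivAt S ((fderiv ℝ Θ (0, u₀)).prod (ContinuousLinearMap.snd ℝ T E)) (0, u₀) :=
    hΘd.prodMk hasFDerivAt_snd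
  have hSinj : Function.Injective
      ((fderiv ℝ Θ (0, u₀)).prod (ContinuousLinearMap.snd ℝ T E)) := by
    refine (injective_iff_map_eq_zero _).2 ?_
    rintro ⟨a, η⟩ h
    obtain rfl : η = 0 := congrArg Prod.snd h
    rw [hinj a (congrArg Prod.fst h)]
    rfl
  have hdim : Module.finrank ℝ (T × E) = Module.finrank ℝ ((T →L[ℝ] ℝ) × E) := by
    have : Module.finrank ℝ (T →L[ℝ] ℝ) = Module.finrank ℝ T := by
      rw [← (LinearMap.toContinuousLinearMap (𝕜 := ℝ) (E := T) (F' := ℝ)).finrank_eq]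
      exact Subspace.dual_finrank_eq
    rw [Module.finrank_prod, Module.finrank_prod, this]
  have hSbij : Function.Bijective
      ((fderiv ℝ Θ (0, u₀)).prod (ContinuousLinearMap.snd ℝ T E)) :=
    ⟨hSinj, (LinearMap.injective_iff_surjective_of_finrank_eq_finrank
      (f := ((fderiv ℝ Θ (0, u₀)).prod (ContinuousLinearMap.snd ℝ T E)).toLinearMap) hdim).1
        hSinj⟩
  obtain ⟨Ψ, hΨ0, hΨ, hright, -⟩ := hS.exists_local_right_inverse hk' hS' hSbij
  have hS0 : S (0, u₀) = (0, u₀) := Prod.ext hΘ0 rfl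
  rw [hS0] at hΨ0 hΨ hright
  refine ⟨fun u => (Ψ (0, u)).1, congrArg Prod.fst hΨ0, ?_, ?_⟩
  · exact contDiffAt_fst.comp u₀
      (ContDiffAt.comp (f := fun u : E => ((0 : T →L[ℝ] ℝ), u)) u₀ hΨ
        (contDiffAt_const.prodMk contDiffAt_id))
  · have hc : Tendsto (fun u : E => ((0 : T →L[ℝ] ℝ), u)) (𝓝 u₀) (𝓝 (0, u₀)) :=
      (by fun_prop : Continuous fun u : E => ((0 : T →L[ℝ] ℝ), u)).tendsto u₀
    filter_upwards [hc.eventually hright] with u hu a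
    have h2 : (Ψ (0, u)).2 = u := congrArg Prod.snd hu
    have h1 : Θ ((Ψ (0, u)).1, u) = 0 := by
      have h1 : Θ (Ψ (0, u)) = 0 := congrArg Prod.fst hu
      rwa [← Prod.mk.eta (p := Ψ (0, u)), h2] at h1
    have h3 := congrArg (fun l : T →L[ℝ] ℝ => l a) h1
    exact sub_eq_zero.1 h3

end CriticalPoints

/-! ### Smoothness of the proximal map at partly smooth functions -/

section PartialSmoothness

variable {E : Type*} [NormedAddCommGroup E] [InnerProductSpace ℝ E]

/-- A point of the relative interior of `S` stays in `S` under small displacements along the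
direction of the affine hull of `S`. -/
lemma exists_pos_add_mem_of_mem_intrinsicInterior {S : Set E} {v : E}
    (hv : v ∈ intrinsicInterior ℝ S) :
    ∃ r > 0, ∀ e ∈ vectorSpan ℝ S, ‖e‖ < r → v + e ∈ S := by
  obtain ⟨y, hy, rfl⟩ := mem_intrinsicInterior.1 hv
  obtain ⟨r, hr, hball⟩ := Metric.mem_nhds_iff.1 (mem_interior_iff_mem_nhds.1 hy)
  refine ⟨r, hr, fun e he hel => ?_⟩
  have hmem : (y : E) + e ∈ affineSpan ℝ S := by
    rw [← direction_affineSpan] at he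
    rw [add_comm]
    exact AffineSubspace.vadd_mem_of_mem_direction he y.2
  have : (⟨(y : E) + e, hmem⟩ : affineSpan ℝ S) ∈ Metric.ball y r := by
    rw [Metric.mem_ball, Subtype.dist_eq, dist_eq_norm, add_sub_cancel_left]
    exact hel
  exact hball this

/-- Inner semicontinuity at `x` is uniform over compact sets of values at `x`. -/
lemma LowerHemicontinuousWithinAt.eventually_forall_exists_dist_lt {X Z : Type*}
    [TopologicalSpace X] [PseudoMetricSpace Z] {F : X → Set Z} {M : Set X} {x : X}
    (hF : LowerHemicontinuousWithinAt F M x) {K : Set Z} (hK : IsCompact K) (hKF : K ⊆ F x)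
    {ε : ℝ} (hε : 0 < ε) : ∀ᶠ y in 𝓝[M] x, ∀ c ∈ K, ∃ q ∈ F y, dist q c < ε := by
  obtain ⟨s, hsK, hsf, hcover⟩ := hK.finite_cover_balls (half_pos hε)
  have h1 : ∀ c ∈ s, ∀ᶠ y in 𝓝[M] x, (F y ∩ Metric.ball c (ε / 2)).Nonempty := fun c hc =>
    lowerHemicontinuousWithinAt_iff.1 hF _ Metric.isOpen_ball
      ⟨c, hKF (hsK hc), Metric.mem_ball_self (half_pos hε)⟩
  filter_upwards [(eventually_all_finite hsf).2 h1] with y hy c hc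
  obtain ⟨c', hc', hcc'⟩ := mem_iUnion₂.1 (hcover hc)
  obtain ⟨q, hq, hqc⟩ := hy c' hc'
  refine ⟨q, hq, ?_⟩
  have := dist_triangle_right q c c'
  rw [Metric.mem_ball] at hqc hcc'
  linarith

/-- A closed convex set `C` that comes within `r/4` of each point of the ball of radius `r` around
`v` in `v + Tᗮ` contains the points `w` close to `v` for which `w - C` is orthogonal to the range of
a map close to the inclusion of `T`: otherwise the direction from `C` to `w` would be
almost in `Tᗮ`, and `C` reaches beyond `w` in that direction. -/
lemma mem_of_approximates_normal_ball [FiniteDimensional ℝ E] {C : Set E} (hC : Convex ℝ C)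
    (hCc : IsClosed C) {T : Submodule ℝ E} {D : T →L[ℝ] E} (hD : ‖T.subtypeL - D‖ ≤ 1 / 4)
    {v w : E} {r : ℝ} (hr : 0 < r) (hw : ‖w - v‖ < r / 4)
    (hnear : ∀ e ∈ Tᗮ, ‖e‖ ≤ r → ∃ q ∈ C, dist q (v + e) < r / 4)
    (horth : ∀ q ∈ C, ∀ a, inner ℝ (w - q) (D a) = 0) : w ∈ C := by
  have : CompleteSpace E := FiniteDimensional.complete ℝ E
  obtain ⟨q₀, hq₀, -⟩ := hnear 0 (zero_mem _) (by simpa using hr.le)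
  obtain ⟨c, hc, hmin⟩ := exists_norm_eq_iInf_of_complete_convex ⟨q₀, hq₀⟩ hCc.isComplete hC w
  have hproj := (norm_eq_iInf_iff_real_inner_le_zero hC hc).1 hmin
  by_contra hwC
  have hwc : 0 < ‖w - c‖ := norm_pos_iff.2 fun H => hwC (by rwa [sub_eq_zero.1 H])
  -- `e` is the unit vector from the nearest point `c` of `C` to `w`, `a` its component in `T`
  set e : E := ‖w - c‖⁻¹ • (w - c)
  have he : ‖e‖ = 1 := by
    rw [norm_smul, norm_inv, norm_norm, inv_mul_cancel₀ hwc.ne']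
  set a : T := T.orthogonalProjectionOnto e
  have hea : e - a ∈ Tᗮ := Submodule.sub_starProjection_mem_orthogonal e
  have hsq : inner ℝ e (a : E) = ‖a‖ ^ 2 := by
    have h1 : inner ℝ (e - a) (a : E) = 0 := Submodule.inner_left_of_mem_orthogonal a.2 hea
    rw [inner_sub_left, real_inner_self_eq_norm_sq] at h1
    exact sub_eq_zero.1 h1
  have ha : ‖a‖ ≤ 1 / 4 := by
    have h1 : inner ℝ e (D a) = 0 := by rw [real_inner_smul_left, horth c hc a, mul_zero]
    have h2 : ‖a‖ ^ 2 = inner ℝ e ((T.subtypeL - D) a) := by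
      rw [← hsq, sub_apply, inner_sub_right, h1, sub_zero]
      rfl
    have h3 : ‖a‖ ^ 2 ≤ 1 / 4 * ‖a‖ := by
      rw [h2]
      refine (real_inner_le_norm _ _).trans ?_
      rw [he, one_mul]
      exact (T.subtypeL - D).le_of_opNorm_le hD a
    by_contra! h4
    nlinarith
  have hean : ‖e - a‖ ≤ 1 := by
    have h1 := norm_sub_sq_real e (a : E)
    rw [hsq, he, ← Submodule.coe_norm] at h1
    nlinarith [norm_nonneg (e - a), sq_nonneg ‖a‖]
  obtain ⟨q, hq, hqd⟩ := hnear (r • (e - a)) (Submodule.smul_mem _ _ hea) (by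
    rw [norm_smul, Real.norm_eq_abs, abs_of_pos hr]
    nlinarith)
  rw [dist_eq_norm] at hqd
  have h1 : inner ℝ e (q - w) < 0 := by
    have h2 := hproj q hq
    have h3 : q - w = (q - c) - (w - c) := by abel
    rw [h3, inner_sub_right]
    simp only [e, real_inner_smul_left, real_inner_self_eq_norm_sq]
    have h4 : ‖w - c‖⁻¹ * ‖w - c‖ ^ 2 = ‖w - c‖ := by field_simp
    rw [h4]
    have := mul_nonpos_of_nonneg_of_nonpos (inv_nonneg.2 hwc.le) h2
    linarith
  have h2 : q - w = (q - (v + r • (e - a))) - (w - v) + r • (e - a) := by abel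
  have h3 := (abs_le.1 (abs_real_inner_le_norm e (q - (v + r • (e - a))))).1
  have h4 := real_inner_le_norm e (w - v)
  have h5 : inner ℝ e (e - a) = 1 - ‖a‖ ^ 2 := by
    rw [inner_sub_right, hsq, real_inner_self_eq_norm_sq, he, one_pow]
  rw [h2, inner_add_right, inner_sub_right, inner_smul_right, h5] at h1
  rw [he, one_mul] at h3 h4
  have h6 : ‖a‖ ^ 2 ≤ 1 / 16 := by nlinarith [norm_nonneg a]
  nlinarith

lemma ContDiffAt.eventually_norm_fderiv_sub_le {A B : Type*} [NormedAddCommGroup A]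
    [NormedSpace ℝ A] [NormedAddCommGroup B] [NormedSpace ℝ B] {f : A → B} {a : A}
    (hf : ContDiffAt ℝ 1 f a) {ε : ℝ} (hε : 0 < ε) :
    ∀ᶠ t in 𝓝 a, ‖fderiv ℝ f a - fderiv ℝ f t‖ ≤ ε := by
  have hc : ContinuousAt (fderiv ℝ f) a := (hf.fderiv_right (m := 0) (by simp)).continuousAt
  filter_upwards [hc (Metric.ball_mem_nhds _ hε)] with t ht
  rw [mem_preimage, Metric.mem_ball, dist_eq_norm, norm_sub_rev] at ht
  exact ht.le

variable {h : E → EReal} {p : ℕ} {x v : E}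

/-- A subgradient of `h` at `φ t` has the same pairing with the range of `Dφ(t)` as the gradient
of any smooth function `g` that agrees with `h` along `φ`. -/
lemma IsProperClosedConvex.fderiv_eq_inner_of_mem_subdiff (hh : IsProperClosedConvex h)
    {T : Type*} [NormedAddCommGroup T] [NormedSpace ℝ T] {φ : T → E} {m : T → ℝ} {t : T}
    (hm : DifferentiableAt ℝ m t) (hφ : DifferentiableAt ℝ φ t)
    (heq : ∀ᶠ s in 𝓝 t, h (φ s) = (m s : EReal)) {q : E} (hq : q ∈ subdiff h (φ t)) (a : T) :
    fderiv ℝ m t a = inner ℝ q (fderiv ℝ φ t a) := by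
  have hmin : IsLocalMin (fun s => m s - innerSL ℝ q (φ s)) t := by
    filter_upwards [heq] with s hs
    have := hh.add_inner_le_toReal hq (y := φ s) (by rw [hs]; exact EReal.coe_ne_top _)
    rw [hs, heq.self_of_nhds, EReal.toReal_coe, EReal.toReal_coe, inner_sub_right] at this
    simp only [innerSL_apply_apply]
    linarith
  have hd := hm.hasFDerivAt.sub ((innerSL ℝ q).hasFDerivAt.comp t hφ.hasFDerivAt)
  have := congrArg (fun l : T →L[ℝ] ℝ => l a) (hmin.hasFDerivAt_eq_zero hd)
  exact sub_eq_zero.1 this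

variable [FiniteDimensional ℝ E]

/-- If `h` is partly smooth at `x` for a relatively interior subgradient `v`, proximal points
near `x + σ⁻¹ v` can be chosen smoothly: they are the critical points of `h + σ/2 ‖· - u‖²` on
the manifold, which are proximal points because nearby subdifferentials are not thinner than
`∂h(x)` in the normal directions. -/
theorem IsPartlySmoothAt.exists_contDiffAt_prox (hps : IsPartlySmoothAt p h x v)
    (hh : IsProperClosedConvex h) (hv : v ∈ intrinsicInterior ℝ (subdiff h x)) {σ : ℝ}
    (hσ : 0 < σ) (hp : 2 ≤ p) :
    ∃ Y : E → E, ContDiffAt ℝ ((p - 1 : ℕ) : WithTop ℕ∞) Y (x + σ⁻¹ • v) ∧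
      ∀ᶠ u in 𝓝 (x + σ⁻¹ • v), σ • (u - Y u) ∈ subdiff h (Y u) := by
  obtain ⟨k, rfl⟩ : ∃ k, p = k + 1 := ⟨p - 1, by omega⟩
  have hk : k ≠ 0 := by omega
  rw [Nat.add_sub_cancel]
  obtain ⟨M, hM⟩ := hps
  obtain ⟨g, hg, hgM⟩ := hM.smooth
  obtain ⟨V, hV, hVF⟩ := hM.inner_semicontinuous
  obtain ⟨T, φ, rfl, hφ, hφ', hφM, hTN⟩ :=
    hM.submanifold.exists_chart (Nat.succ_ne_zero k) hM.mem
  rw [Nat.cast_add, Nat.cast_one] at hφ hg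
  set m : T → ℝ := fun t => g (φ t)
  have hm : ContDiffAt ℝ (k + 1) m 0 := hg.comp 0 hφ
  have hφtend : Tendsto φ (𝓝 0) (𝓝[M] (φ 0)) :=
    tendsto_nhdsWithin_iff.2 ⟨hφ.continuousAt, hφM⟩
  have heq : ∀ᶠ t in 𝓝 (0 : T), h (φ t) = (m t : EReal) := hφtend.eventually hgM
  have hmin : ∀ᶠ t in 𝓝 (0 : T), m 0 + inner ℝ v (φ t - φ 0) ≤ m t := by
    filter_upwards [heq] with t ht
    have := hh.add_inner_le_toReal hM.mem_subdiff (y := φ t)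
      (by rw [ht]; exact EReal.coe_ne_top _)
    rwa [ht, heq.self_of_nhds, EReal.toReal_coe, EReal.toReal_coe] at this
  obtain ⟨τ, hτ0, hτ, hcrit⟩ := exists_contDiffAt_critical_point hσ hk hm hφ
    (by rw [hφ'.fderiv]; exact Subtype.val_injective) hmin
  set u₀ : E := φ 0 + σ⁻¹ • v
  have hY : ContDiffAt ℝ k (fun u => φ (τ u)) u₀ := by
    refine ContDiffAt.comp u₀ ?_ hτ
    rw [hτ0]
    exact hφ.of_le (by exact_mod_cast Nat.le_succ k)
  refine ⟨fun u => φ (τ u), hY, ?_⟩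
  -- around `v`, the subdifferential at `x` contains a ball of the normal space
  obtain ⟨r₁, hr₁, hball⟩ := exists_pos_add_mem_of_mem_intrinsicInterior hv
  obtain ⟨r₂, hr₂, hVball⟩ := Metric.mem_nhds_iff.1 hV
  set r : ℝ := min r₁ r₂ / 2
  have hr : 0 < r := half_pos (lt_min hr₁ hr₂)
  have hrlt : r < min r₁ r₂ := half_lt_self (lt_min hr₁ hr₂)
  set K : Set E := (fun e => v + e) '' (Metric.closedBall 0 r ∩ Tᗮ)
  have hK : IsCompact K := by
    have : ProperSpace E := FiniteDimensional.proper ℝ E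
    exact ((isCompact_closedBall _ _).inter_right (Submodule.isClosed_orthogonal T)).image
      (by fun_prop)
  have hKV : K ⊆ V ∩ subdiff h (φ 0) := by
    rintro _ ⟨e, ⟨her, heT⟩, rfl⟩
    rw [mem_closedBall_zero_iff] at her
    refine ⟨hVball ?_, hball e ?_ ?_⟩
    · rw [Metric.mem_ball, dist_eq_norm, add_sub_cancel_left]
      exact her.trans_lt (hrlt.trans_le (min_le_right _ _))
    · rw [hM.sharp]
      exact hTN heT
    · exact her.trans_lt (hrlt.trans_le (min_le_left _ _))
  have hnear := hφtend.eventually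
    (hVF.eventually_forall_exists_dist_lt hK hKV (by positivity : 0 < r / 4))
  have hd1 : (1 : WithTop ℕ∞) ≤ k + 1 := by
    exact_mod_cast Nat.one_le_iff_ne_zero.2 (Nat.succ_ne_zero k)
  have hmd : ∀ᶠ t in 𝓝 (0 : T), DifferentiableAt ℝ m t :=
    ((hm.of_le hd1).eventually (by simp)).mono fun t ht => ht.differentiableAt one_ne_zero
  have hφd : ∀ᶠ t in 𝓝 (0 : T), DifferentiableAt ℝ φ t :=
    ((hφ.of_le hd1).eventually (by simp)).mono fun t ht => ht.differentiableAt one_ne_zero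
  have hDφ : ∀ᶠ t in 𝓝 (0 : T), ‖T.subtypeL - fderiv ℝ φ t‖ ≤ 1 / 4 := by
    rw [← hφ'.fderiv]
    exact (hφ.of_le hd1).eventually_norm_fderiv_sub_le (by norm_num)
  have hτt : Tendsto τ (𝓝 u₀) (𝓝 0) := by
    have := hτ.continuousAt.tendsto
    rwa [hτ0] at this
  have hw : ∀ᶠ u in 𝓝 u₀, ‖σ • (u - φ (τ u)) - v‖ < r / 4 := by
    have hc : ContinuousAt (fun u => ‖σ • (u - φ (τ u)) - v‖) u₀ :=
      (((continuousAt_id.sub hY.continuousAt).const_smul σ).sub continuousAt_const).norm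
    have h0 : ‖σ • (u₀ - φ (τ u₀)) - v‖ = 0 := by
      rw [hτ0]
      simp only [u₀, add_sub_cancel_left]
      rw [smul_inv_smul₀ hσ.ne', sub_self, norm_zero]
    refine hc.eventually_lt continuousAt_const ?_
    rw [h0]
    positivity
  filter_upwards [hcrit, hw, hτt.eventually hnear, hτt.eventually hmd, hτt.eventually hφd,
    hτt.eventually hDφ, hτt.eventually heq.eventually_nhds] with u h1 h2 h3 h4 h5 h6 h7
  refine mem_of_approximates_normal_ball (hh.convex_subdiff _) (hh.isClosed_subdiff _) h6 hr h2 ?_ ?_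
  · intro e heT her
    obtain ⟨q, hq, hqd⟩ := h3 (v + e) ⟨e, ⟨mem_closedBall_zero_iff.2 her, heT⟩, rfl⟩
    exact ⟨q, hq.2, hqd⟩
  · intro q hq a
    rw [inner_sub_left, ← h1 a, hh.fderiv_eq_inner_of_mem_subdiff h4 h5 h7 hq a, sub_self]

/-- The Moreau envelope of a partly smooth function is as smooth as the function along its
manifold. -/
theorem IsPartlySmoothAt.contDiffAt_moreauEnv (hps : IsPartlySmoothAt p h x v)
    (hh : IsProperClosedConvex h) (hv : v ∈ intrinsicInterior ℝ (subdiff h x)) {σ : ℝ}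
    (hσ : 0 < σ) (hp : 2 ≤ p) : ContDiffAt ℝ p (moreauEnv h σ) (x + σ⁻¹ • v) := by
  obtain ⟨Y, hY, hmem⟩ := hps.exists_contDiffAt_prox hh hv hσ hp
  have := hh.contDiffAt_moreauEnv hσ hY hmem
  have e : p = p - 1 + 1 := by omega
  rw [e]
  exact_mod_cast this

/-- A differentiable function that is partly smooth at `x` is `C^p` there: its subdifferential is a
singleton, so the manifold is open. -/
lemma IsPartlySmoothAt.contDiffAt_of_differentiable {f : E → ℝ} (hf : DifferentiableAt ℝ f x)
    (hp : p ≠ 0) (hps : IsPartlySmoothAt p (fun y => (f y : EReal)) x v) : ContDiffAt ℝ p f x := by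
  obtain ⟨M, hM⟩ := hps
  have huniq : ∀ q ∈ subdiff (fun y => (f y : EReal)) x, ∀ a, fderiv ℝ f x a = inner ℝ q a := by
    intro q hq a
    have hmin : IsLocalMin (fun s => f s - innerSL ℝ q s) x := by
      refine Eventually.of_forall fun s => ?_
      have h1 : f x + inner ℝ q (s - x) ≤ f s := EReal.coe_le_coe_iff.1 (hq s)
      rw [inner_sub_right] at h1
      simp only [innerSL_apply_apply]
      linarith
    have hd := hmin.hasFDerivAt_eq_zero (hf.hasFDerivAt.sub (innerSL ℝ q).hasFDerivAt)
    exact sub_eq_zero.1 (congrArg (fun l : E →L[ℝ] ℝ => l a) hd)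
  have hsub : (subdiff (fun y => (f y : EReal)) x).Subsingleton := fun q hq q' hq' =>
    ext_inner_right ℝ fun a => by rw [← huniq q hq a, huniq q' hq' a]
  have hN : normalSpace M x = ⊥ := by
    rw [← hM.sharp]
    exact vectorSpan_of_subsingleton ℝ hsub
  have hMx := hM.submanifold.mem_nhds_of_normalSpace_eq_bot hp hM.mem hN
  obtain ⟨g, hg, hgM⟩ := hM.smooth
  rw [nhdsWithin_eq_nhds.2 hMx] at hgM
  exact hg.congr_of_eventuallyEq (hgM.mono fun y hy => by exact_mod_cast hy)

end PartialSmoothness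

/-! ### Gradients along affine slices -/

section Gradients

variable {A W : Type*} [NormedAddCommGroup A] [InnerProductSpace ℝ A] [FiniteDimensional ℝ A]
  [NormedAddCommGroup W] [NormedSpace ℝ W]

variable (A) in
/-- The Riesz isomorphism from the dual of a finite-dimensional space, as a continuous
`ℝ`-linear map. -/
def rieszL : (A →L[ℝ] ℝ) →L[ℝ] A :=
  haveI : CompleteSpace A := FiniteDimensional.complete ℝ A
  LinearMap.toContinuousLinearMap
    { toFun := (InnerProductSpace.toDual ℝ A).symm
      map_add' := map_add _
      map_smul' := fun c l => by simp }

lemma grad_comp_eq {Ψ : W → ℝ} {w : W} (hΨ : DifferentiableAt ℝ Ψ w) {c : A → W} {ι : A →L[ℝ] W}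
    {a : A} (hc : HasFDerivAt c ι a) (hca : c a = w) :
    grad (fun a' => Ψ (c a')) a = rieszL A ((fderiv ℝ Ψ w).comp ι) := by
  subst hca
  have : fderiv ℝ (fun a' => Ψ (c a')) a = (fderiv ℝ Ψ (c a)).comp ι :=
    (hΨ.hasFDerivAt.comp a hc).fderiv
  rw [grad, gradient, this]
  rfl

variable {B : Type*} [NormedAddCommGroup B] [InnerProductSpace ℝ B] [FiniteDimensional ℝ B]

/-- The saddle gradient `(∇_a Ψ, -∇_b Ψ)` of a `C^{k+1}` function is `C^k`. -/
lemma ContDiffAt.saddle_grad {Ψ : WithLp 2 (A × B) → ℝ} (hd : Differentiable ℝ Ψ)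
    {w : WithLp 2 (A × B)} {k : ℕ} (hΨ : ContDiffAt ℝ (k + 1) Ψ w) :
    ContDiffAt ℝ k (fun w : WithLp 2 (A × B) =>
      WithLp.toLp 2 (grad (fun a => Ψ (WithLp.toLp 2 (a, w.snd))) w.fst,
        -grad (fun b => Ψ (WithLp.toLp 2 (w.fst, b))) w.snd)) w := by
  set e := (WithLp.prodContinuousLinearEquiv 2 ℝ A B).symm
  have h1 : ∀ w : WithLp 2 (A × B), grad (fun a => Ψ (WithLp.toLp 2 (a, w.snd))) w.fst =
      rieszL A ((fderiv ℝ Ψ w).comp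
        ((e : A × B →L[ℝ] WithLp 2 (A × B)).comp (ContinuousLinearMap.inl ℝ A B))) := fun w =>
    grad_comp_eq (hd w) ((e : A × B →L[ℝ] WithLp 2 (A × B)).hasFDerivAt.comp w.fst
      ((hasFDerivAt_id _).prodMk (hasFDerivAt_const _ _))) rfl
  have h2 : ∀ w : WithLp 2 (A × B), grad (fun b => Ψ (WithLp.toLp 2 (w.fst, b))) w.snd =
      rieszL B ((fderiv ℝ Ψ w).comp
        ((e : A × B →L[ℝ] WithLp 2 (A × B)).comp (ContinuousLinearMap.inr ℝ A B))) := fun w =>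
    grad_comp_eq (hd w) ((e : A × B →L[ℝ] WithLp 2 (A × B)).hasFDerivAt.comp w.snd
      ((hasFDerivAt_const _ _).prodMk (hasFDerivAt_id _))) rfl
  simp only [h1, h2]
  have hf : ContDiffAt ℝ k (fderiv ℝ Ψ) w := hΨ.fderiv_right le_rfl
  refine (e : A × B →L[ℝ] WithLp 2 (A × B)).contDiff.contDiffAt.comp w (ContDiffAt.prodMk ?_ ?_)
  · exact (rieszL A).contDiff.contDiffAt.comp w (hf.clm_comp contDiffAt_const)
  · exact ((rieszL B).contDiff.contDiffAt.comp w (hf.clm_comp contDiffAt_const)).neg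

end Gradients

/-! ### Coordinates of the primal-dual space -/

section Coordinates

variable {n₁ n₂ : ℕ} {X₁ : Fin n₁ → Type*} {X₂ : Fin n₂ → Type*} {Y : Type*}
  [∀ i, NormedAddCommGroup (X₁ i)] [∀ i, InnerProductSpace ℝ (X₁ i)]
  [∀ j, NormedAddCommGroup (X₂ j)] [∀ j, InnerProductSpace ℝ (X₂ j)]
  [NormedAddCommGroup Y] [InnerProductSpace ℝ Y] {n : WithTop ℕ∞}

namespace PDSpace

lemma contDiff_x₁ (i : Fin n₁) : ContDiff ℝ n fun w : PDSpace X₁ X₂ Y => w.fst.fst i :=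
  ((PiLp.proj 2 X₁ i).comp ((WithLp.fstL 2 ℝ _ _).comp (WithLp.fstL 2 ℝ _ _)) :
    PDSpace X₁ X₂ Y →L[ℝ] X₁ i).contDiff

lemma contDiff_x₂ (j : Fin n₂) : ContDiff ℝ n fun w : PDSpace X₁ X₂ Y => w.fst.snd j :=
  ((PiLp.proj 2 X₂ j).comp ((WithLp.sndL 2 ℝ _ _).comp (WithLp.fstL 2 ℝ _ _)) :
    PDSpace X₁ X₂ Y →L[ℝ] X₂ j).contDiff

lemma contDiff_z₂ (j : Fin n₂) : ContDiff ℝ n fun w : PDSpace X₁ X₂ Y => w.snd.fst j :=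
  ((PiLp.proj 2 X₂ j).comp ((WithLp.fstL 2 ℝ _ _).comp (WithLp.sndL 2 ℝ _ _)) :
    PDSpace X₁ X₂ Y →L[ℝ] X₂ j).contDiff

lemma contDiff_zₙ : ContDiff ℝ n fun w : PDSpace X₁ X₂ Y => w.snd.snd :=
  ((WithLp.sndL 2 ℝ _ _).comp (WithLp.sndL 2 ℝ _ _) : PDSpace X₁ X₂ Y →L[ℝ] Y).contDiff

lemma contDiff_shift₂ (σ : ℝ) (j : Fin n₂) :
    ContDiff ℝ n fun w : PDSpace X₁ X₂ Y => w.fst.snd j - σ⁻¹ • w.snd.fst j :=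
  (contDiff_x₂ j).sub ((contDiff_z₂ j).const_smul _)

lemma contDiff_multiplierNorm (σ : ℝ) : ContDiff ℝ n fun w : PDSpace X₁ X₂ Y =>
    1 / (2 * σ) * (∑ j, ‖w.snd.fst j‖ ^ 2 + ‖w.snd.snd‖ ^ 2) :=
  contDiff_const.mul ((ContDiff.sum fun j _ => (contDiff_z₂ j).norm_sq ℝ).add
    (contDiff_zₙ.norm_sq ℝ))

end PDSpace

end Coordinates

/-! ### The saddle function as a sum of Moreau envelopes -/

lemma EReal.coe_sum_real {ι : Type*} (s : Finset ι) (f : ι → ℝ) :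
    ((∑ i ∈ s, f i : ℝ) : EReal) = ∑ i ∈ s, (f i : EReal) :=
  map_sum (⟨⟨Real.toEReal, EReal.coe_zero⟩, EReal.coe_add⟩ : ℝ →+ EReal) f s

namespace MultiBlockProblem

variable {n₁ n₂ : ℕ} {X₁ : Fin n₁ → Type*} {X₂ : Fin n₂ → Type*} {Y : Type*}
  [∀ i, NormedAddCommGroup (X₁ i)] [∀ i, InnerProductSpace ℝ (X₁ i)]
  [∀ i, FiniteDimensional ℝ (X₁ i)]
  [∀ j, NormedAddCommGroup (X₂ j)] [∀ j, InnerProductSpace ℝ (X₂ j)]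
  [∀ j, FiniteDimensional ℝ (X₂ j)]
  [NormedAddCommGroup Y] [InnerProductSpace ℝ Y] [FiniteDimensional ℝ Y]
  (P : MultiBlockProblem X₁ X₂ Y)

/-- The augmented Lagrangian minimized over `(y, x_n)`, in closed form: the minimization separates
into the proximal problems of the nonsmooth terms. -/
def envelopeSum (σ : ℝ) (w : PDSpace X₁ X₂ Y) : ℝ :=
  (∑ i, P.h₁ i (w.fst.fst i) - 1 / (2 * σ) * (∑ j, ‖w.snd.fst j‖ ^ 2 + ‖w.snd.snd‖ ^ 2))
    + (∑ j, moreauEnv (P.h₂ j) σ (w.fst.snd j - σ⁻¹ • w.snd.fst j)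
      + moreauEnv P.hₙ σ
        (P.b - P.lin (fun i => w.fst.fst i) (fun j => w.fst.snd j) - σ⁻¹ • w.snd.snd))

lemma augLagrangian_eq_separated (σ : ℝ) (x₁ : ∀ i, X₁ i) (x₂ : ∀ j, X₂ j) (xₙ : Y)
    (y z₂ : ∀ j, X₂ j) (zₙ : Y) :
    P.augLagrangian σ x₁ x₂ xₙ y z₂ zₙ =
      ((∑ i, P.h₁ i (x₁ i) - 1 / (2 * σ) * (∑ j, ‖z₂ j‖ ^ 2 + ‖zₙ‖ ^ 2) : ℝ) : EReal)
      + (∑ j, (P.h₂ j (y j) + ((σ / 2 * ‖x₂ j - σ⁻¹ • z₂ j - y j‖ ^ 2 : ℝ) : EReal))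
        + (P.hₙ xₙ + ((σ / 2 * ‖P.b - P.lin x₁ x₂ - σ⁻¹ • zₙ - xₙ‖ ^ 2 : ℝ) : EReal))) := by
  have e1 : ‖P.lin x₁ x₂ + xₙ - P.b + σ⁻¹ • zₙ‖ = ‖P.b - P.lin x₁ x₂ - σ⁻¹ • zₙ - xₙ‖ := by
    rw [← norm_neg]; congr 1; abel
  have e2 : ∀ j, x₂ j - y j - σ⁻¹ • z₂ j = x₂ j - σ⁻¹ • z₂ j - y j := fun j => by abel
  rw [augLagrangian, e1, Finset.sum_add_distrib, ← EReal.coe_sum_real, Finset.mul_sum]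
  simp only [e2]
  generalize ∑ i, P.h₁ i (x₁ i) - 1 / (2 * σ) * (∑ j, ‖z₂ j‖ ^ 2 + ‖zₙ‖ ^ 2) = c
  generalize σ / 2 * ‖P.b - P.lin x₁ x₂ - σ⁻¹ • zₙ - xₙ‖ ^ 2 = q
  generalize ∑ j, σ / 2 * ‖x₂ j - σ⁻¹ • z₂ j - y j‖ ^ 2 = r
  rw [EReal.coe_add, EReal.coe_add]
  abel

variable {P} {σ : ℝ}

/-- Subgradients at one point of each nonsmooth term make all proximal problems solvable, so that
the infimum defining `Φ` is attained. -/
lemma phiE_eq (hσ : 0 < σ) {x₂ v₂ : ∀ j, X₂ j} {xₙ vₙ : Y}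
    (hv₂ : ∀ j, v₂ j ∈ subdiff (P.h₂ j) (x₂ j)) (hvₙ : vₙ ∈ subdiff P.hₙ xₙ)
    (x : PrimalSpace X₁ X₂) (z : DualSpace X₂ Y) :
    P.PhiE σ x z = (P.envelopeSum σ (WithLp.toLp 2 (x, z)) : EReal) := by
  apply le_antisymm
  · refine iInf₂_le_of_le (fun j => proxPoint (P.h₂ j) σ (x.snd j - σ⁻¹ • z.fst j))
      (proxPoint P.hₙ σ
        (P.b - P.lin (fun i => x.fst i) (fun j => x.snd j) - σ⁻¹ • z.snd)) (le_of_eq ?_)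
    rw [augLagrangian_eq_separated, envelopeSum, EReal.coe_add, EReal.coe_add, EReal.coe_sum_real,
      P.hₙ_pcc.coe_moreauEnv hσ hvₙ]
    simp only [(P.h₂_pcc _).coe_moreauEnv hσ (hv₂ _)]
    rfl
  · refine le_iInf₂ fun y yₙ => ?_
    rw [augLagrangian_eq_separated, envelopeSum, EReal.coe_add, EReal.coe_add, EReal.coe_sum_real]
    exact add_le_add le_rfl (add_le_add
      (Finset.sum_le_sum fun j _ => (P.h₂_pcc j).moreauEnv_le hσ (hv₂ j) _ _)
      (P.hₙ_pcc.moreauEnv_le hσ hvₙ _ _))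

section EnvelopeArguments

variable {n : WithTop ℕ∞}

variable (P) in
lemma contDiff_lin : ContDiff ℝ n fun w : PDSpace X₁ X₂ Y =>
    P.lin (fun i => w.fst.fst i) (fun j => w.fst.snd j) := by
  refine ContDiff.add (ContDiff.sum fun i _ => ?_) (ContDiff.sum fun j _ => ?_)
  · exact (LinearMap.toContinuousLinearMap (P.A₁ i)).contDiff.comp (PDSpace.contDiff_x₁ i)
  · exact (LinearMap.toContinuousLinearMap (P.A₂ j)).contDiff.comp (PDSpace.contDiff_x₂ j)

variable (P) in
lemma contDiff_shiftₙ (σ : ℝ) : ContDiff ℝ n fun w : PDSpace X₁ X₂ Y =>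
    P.b - P.lin (fun i => w.fst.fst i) (fun j => w.fst.snd j) - σ⁻¹ • w.snd.snd :=
  (contDiff_const.sub P.contDiff_lin).sub (PDSpace.contDiff_zₙ.const_smul _)

end EnvelopeArguments

lemma differentiable_envelopeSum (hσ : 0 < σ) {x₂ v₂ : ∀ j, X₂ j} {xₙ vₙ : Y}
    (hv₂ : ∀ j, v₂ j ∈ subdiff (P.h₂ j) (x₂ j)) (hvₙ : vₙ ∈ subdiff P.hₙ xₙ) :
    Differentiable ℝ (P.envelopeSum σ) := by
  have h1 : (1 : WithTop ℕ∞) ≠ 0 := one_ne_zero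
  refine Differentiable.add (Differentiable.sub (Differentiable.fun_sum fun i _ => ?_)
    ((PDSpace.contDiff_multiplierNorm σ).differentiable h1))
    (Differentiable.add (Differentiable.fun_sum fun j _ => ?_) ?_)
  · exact ((P.h₁_contDiff i).differentiable two_ne_zero).comp
      ((PDSpace.contDiff_x₁ i).differentiable h1)
  · exact Differentiable.comp (g := moreauEnv (P.h₂ j) σ)
      (fun u => ((P.h₂_pcc j).hasFDerivAt_moreauEnv hσ (hv₂ j) u).differentiableAt)
      ((PDSpace.contDiff_shift₂ σ j).differentiable h1)
  · exact Differentiable.comp (g := moreauEnv P.hₙ σ)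
      (fun u => (P.hₙ_pcc.hasFDerivAt_moreauEnv hσ hvₙ u).differentiableAt)
      ((P.contDiff_shiftₙ σ).differentiable h1)

/-- At a strictly complementary KKT point with partly smooth terms, the arguments of the envelopes
are `x_j - σ⁻¹ z_j`, and the envelopes are `C^p` there. -/
lemma contDiffAt_envelopeSum (hσ : 0 < σ) {p : ℕ} (hp : 2 ≤ p)
    {x₁ : ∀ i, X₁ i} {x₂ : ∀ j, X₂ j} {xₙ : Y} {z₂ : ∀ j, X₂ j} {zₙ : Y}
    (hfeas : P.Feasible x₁ x₂ xₙ) (hsc : P.StrictCompl x₂ xₙ z₂ zₙ)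
    (hps : P.PartlySmooth p x₁ x₂ xₙ z₂ zₙ) :
    ContDiffAt ℝ p (P.envelopeSum σ) (pdPoint x₁ x₂ z₂ zₙ) := by
  obtain ⟨hps₁, hps₂, hpsₙ⟩ := hps
  refine ContDiffAt.add (ContDiffAt.sub (ContDiffAt.sum fun i _ => ?_)
    (PDSpace.contDiff_multiplierNorm σ).contDiffAt)
    (ContDiffAt.add (ContDiffAt.sum fun j _ => ?_) ?_)
  · refine ContDiffAt.comp (g := P.h₁ i) _ ?_ (PDSpace.contDiff_x₁ i).contDiffAt
    exact (hps₁ i).contDiffAt_of_differentiable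
      ((P.h₁_contDiff i).differentiable two_ne_zero _) (by omega)
  · refine ContDiffAt.comp (g := moreauEnv (P.h₂ j) σ) _ ?_ (PDSpace.contDiff_shift₂ σ j).contDiffAt
    have e : (pdPoint x₁ x₂ z₂ zₙ).fst.snd j - σ⁻¹ • (pdPoint x₁ x₂ z₂ zₙ).snd.fst j
        = x₂ j + σ⁻¹ • -z₂ j := by
      rw [smul_neg, ← sub_eq_add_neg]
      rfl
    rw [e]
    exact (hps₂ j).contDiffAt_moreauEnv (P.h₂_pcc j) (hsc.1 j) hσ hp
  · refine ContDiffAt.comp (g := moreauEnv P.hₙ σ) _ ?_ (P.contDiff_shiftₙ σ).contDiffAt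
    have e : P.b - P.lin (fun i => (pdPoint x₁ x₂ z₂ zₙ).fst.fst i)
        (fun j => (pdPoint x₁ x₂ z₂ zₙ).fst.snd j) - σ⁻¹ • (pdPoint x₁ x₂ z₂ zₙ).snd.snd
        = xₙ + σ⁻¹ • -zₙ := by
      change P.b - P.lin x₁ x₂ - σ⁻¹ • zₙ = _
      rw [← hfeas]
      module
    rw [e]
    exact hpsₙ.contDiffAt_moreauEnv P.hₙ_pcc hsc.2 hσ hp

end MultiBlockProblem

end

theorem mainTheorem4 {n₁ n₂ : ℕ} {X₁ : Fin n₁ → Type*} {X₂ : Fin n₂ → Type*} {Y : Type*}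
    [∀ i, NormedAddCommGroup (X₁ i)] [∀ i, InnerProductSpace ℝ (X₁ i)]
    [∀ i, FiniteDimensional ℝ (X₁ i)]
    [∀ j, NormedAddCommGroup (X₂ j)] [∀ j, InnerProductSpace ℝ (X₂ j)]
    [∀ j, FiniteDimensional ℝ (X₂ j)]
    [NormedAddCommGroup Y] [InnerProductSpace ℝ Y] [FiniteDimensional ℝ Y]
    (P : MultiBlockProblem X₁ X₂ Y) (σ : ℝ) (hσ : 0 < σ) (p : ℕ) (hp : 2 ≤ p)
    (hopt : ∃ x₁ x₂ xₙ, P.IsOptimal x₁ x₂ xₙ) (hslater : P.Slater)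
    (x₁ : ∀ i, X₁ i) (x₂ : ∀ j, X₂ j) (xₙ : Y) (z₂ : ∀ j, X₂ j) (zₙ : Y)
    (hkkt : P.IsKKT x₁ x₂ xₙ z₂ zₙ)
    (hsc : P.StrictCompl x₂ xₙ z₂ zₙ)
    (hps : P.PartlySmooth p x₁ x₂ xₙ z₂ zₙ) :
    (∀ x z, ∃ r : ℝ, P.PhiE σ x z = (r : EReal)) ∧
    Differentiable ℝ (fun w : PDSpace X₁ X₂ Y => P.Phi σ w.fst w.snd) ∧
    ∃ U : Set (PDSpace X₁ X₂ Y), IsOpen U ∧ pdPoint x₁ x₂ z₂ zₙ ∈ U ∧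
      ContDiffOn ℝ ((p - 1 : ℕ) : WithTop ℕ∞) (P.F σ) U := by
  have hphi := MultiBlockProblem.phiE_eq hσ hkkt.mem_subdiff₂ hkkt.mem_subdiffₙ
  have hΦ : ∀ x z, P.Phi σ x z = P.envelopeSum σ (WithLp.toLp 2 (x, z)) := fun x z => by
    rw [MultiBlockProblem.Phi, hphi, EReal.toReal_coe]
  have hd : Differentiable ℝ (P.envelopeSum σ) :=
    MultiBlockProblem.differentiable_envelopeSum hσ hkkt.mem_subdiff₂ hkkt.mem_subdiffₙ
  refine ⟨fun x z => ⟨_, hphi x z⟩, ?_, ?_⟩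
  · simp only [hΦ]
    exact hd
  · obtain ⟨k, rfl⟩ : ∃ k, p = k + 1 := ⟨p - 1, by omega⟩
    have hC := MultiBlockProblem.contDiffAt_envelopeSum hσ hp hkkt.feasible hsc hps
    rw [Nat.cast_add, Nat.cast_one] at hC
    have hF : ContDiffAt ℝ k (P.F σ) (pdPoint x₁ x₂ z₂ zₙ) := by
      have := hC.saddle_grad hd
      simp only [← hΦ] at this
      exact this
    rw [Nat.add_sub_cancel]
    obtain ⟨U, hU, hUF⟩ := hF.contDiffOn le_rfl (by simp)
    obtain ⟨V, hVU, hVo, hVmem⟩ := mem_nhds_iff.1 (by simpa using hU)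
    exact ⟨V, hVo, hVmem, hUF.mono hVU⟩
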